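/- **Notation.** For complex matrices, $A^*$, $r(A)$ and $\mathscr R(A)$ are the conjugate transpose, rank and column space of $A$; $[A,\,B]$ is a row block matrix; $\mathbb C_{\rm H}^{m}$ is the set of $m\times m$ complex Hermitian matrices; $i_+(A)$ and $i_-(A)$ are the numbers of positive and negative eigenvalues of a Hermitian $A$, counted with multiplicity; $A\succcurlyeq B$ ($A\succ B$) means that $A-B$ is Hermitian positive semi-definite (positive definite). **Theorem 3.4.** Let $A_i\in\mathbb C_{\rm H}^{m_i}$ and $B_i\in\mathbb C^{m_i\times n}$, $i=1,2$, and put $$M=\begin{bmatrix}A_1&0&B_1\\0&-A_2&B_2\\B_1^*&B_2^*&0\end{bmatrix},\quad N=\begin{bmatrix}A_1&B_1&0\\B_1^*&0&B_2^*\end{bmatrix},\quad M_1=\begin{bmatrix}A_1&B_1\\B_1^*&0\end{bmatrix},\quad \mathcal T_2=\{X\in\mathbb C_{\rm H}^{n}\mid B_2XB_2^*\preccurlyeq A_2\}.$$ Then $\mathcal T_2\neq\emptyset$ if and only if $i_+\begin{bmatrix}A_2&B_2\\B_2^*&0\end{bmatrix}=r[A_2,\,B_2]$. Assume that $\mathcal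 T_2\ne\emptyset$. Then the following extremal values are attained and equal $$\begin{aligned} \max_{X\in\mathcal T_2}r(A_1-B_1XB_1^*)&=r[A_1,B_1],\\ \min_{X\in\mathcal T_2}r(A_1-B_1XB_1^*)&=2r[A_1,B_1]+i_+(M)-i_+(M_1)-r(N),\\ \max_{X\in\mathcal T_2}i_+(A_1-B_1XB_1^*)&=i_+(M_1),\\ \min_{X\in\mathcal T_2}i_+(A_1-B_1XB_1^*)&=r[A_1,B_1]-r(N)+i_+(M),\\ \max_{X\in\mathcal T_2}i_-(A_1-B_1XB_1^*)&=i_-(M)-r[A_2,B_2],\\ \min_{X\in\mathcal T_2}i_-(A_1-B_1XB_1^*)&=r[A_1,B_1]-i_+(M_1). \end{aligned}$$ In consequence, the following hold. (a) There is an $X\in\mathcal T_2$ such that $A_1-B_1XB_1^*$ is nonsingular if and only if $r[A_1,B_1]=m_1$. (b) $A_1-B_1XB_1^*$ is nonsingular for all $X\in\mathcal T_2$ if and only if $r[A_1,B_1]=m_1$ and $i_+(M)=i_+(M_1)+r(N)-m_1$. (c) There is an $X\in\mathcal T_2$ such that $B_1XB_1^*=A_1$ if and only if $\mathscr R(A_1)\subseteq\mathscr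 R(B_1)$ and $i_+(M)=r\begin{bmatrix}B_1\\B_2\end{bmatrix}$. (d) There is an $X\in\mathcal T_2$ such that $B_1XB_1^*\prec A_1$ if and only if $i_+(M_1)=m_1$. (e) There is an $X\in\mathcal T_2$ such that $B_1XB_1^*\succ A_1$ if and only if $i_-(M)=r[A_2,B_2]+m_1$. (f) There is an $X\in\mathcal T_2$ such that $B_1XB_1^*\preccurlyeq A_1$ if and only if $i_+(M_1)=r[A_1,B_1]$. (g) There is an $X\in\mathcal T_2$ such that $B_1XB_1^*\succcurlyeq A_1$ if and only if $i_+(M)=r(N)-r[A_1,B_1]$. (h) $B_1XB_1^*\preccurlyeq A_1$ for all $X\in\mathcal T_2$, i.e., $\mathcal T_2\subseteq\{X\in\mathbb C_{\rm H}^n\mid B_1XB_1^*\preccurlyeq A_1\}$, if and only if $i_-(M)=r[A_2,B_2]$. (i) The rank of $A_1-B_1XB_1^*$ is the same for all $X\in\mathcal T_2$ if and only if $i_+(M)=i_+(M_1)+r(N)-r[A_1,B_1]$. (j) $i_+(A_1-B_1XB_1^*)$ is the same for all $X\in\mathcal T_2$ if and only if $i_+(M_1)+r(N)=r[A_1,B_1]+i_+(M)$.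 (k) $i_-(A_1-B_1XB_1^*)$ is the same for all $X\in\mathcal T_2$ if and only if $i_-(M)+i_+(M_1)=r[A_1,B_1]+r[A_2,B_2]$. -/

import Mathlib

open Matrix
open scoped ComplexOrder

noncomputable section

/-- `i₊(A)`: the number of positive eigenvalues of `A`, counted with multiplicity
(as roots of the characteristic polynomial). For a complex number `z`, `0 < z` says that `z` is
real and positive. -/
def posInertia {ι : Type*} [Fintype ι] [DecidableEq ι] (A : Matrix ι ι ℂ) : ℕ :=
  Multiset.card (open Classical in A.charpoly.roots.filter (fun z : ℂ => 0 < z))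

/-- `i₋(A)`: the number of negative eigenvalues of `A`, counted with multiplicity. -/
def negInertia {ι : Type*} [Fintype ι] [DecidableEq ι] (A : Matrix ι ι ℂ) : ℕ :=
  Multiset.card (open Classical in A.charpoly.roots.filter (fun z : ℂ => z < 0))

/-- The range (column space) of a matrix. -/
def colSpace {ι κ : Type*} [Fintype κ] (A : Matrix ι κ ℂ) : Submodule ℂ (ι → ℂ) :=
  LinearMap.range A.mulVecLin

/-- The Hermitian matrices `X` with `B X B* ≼ A`. -/
def lmiSolutions {m n : ℕ} (A : Matrix (Fin m) (Fin m) ℂ) (B : Matrix (Fin m) (Fin n) ℂ) :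
    Set (Matrix (Fin n) (Fin n) ℂ) :=
  {X | X.IsHermitian ∧ (A - B * X * Bᴴ).PosSemidef}

/-- The bordered matrix `[A, B; B*, 0]`. -/
def bordered {m n : ℕ} (A : Matrix (Fin m) (Fin m) ℂ) (B : Matrix (Fin m) (Fin n) ℂ) :
    Matrix (Fin m ⊕ Fin n) (Fin m ⊕ Fin n) ℂ :=
  fromBlocks A B Bᴴ 0

/-- The matrix `M = [A₁, 0, B₁; 0, -A₂, B₂; B₁*, B₂*, 0]`. -/
def blockM {m₁ m₂ n : ℕ}
    (A₁ : Matrix (Fin m₁) (Fin m₁) ℂ) (B₁ : Matrix (Fin m₁) (Fin n) ℂ)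
    (A₂ : Matrix (Fin m₂) (Fin m₂) ℂ) (B₂ : Matrix (Fin m₂) (Fin n) ℂ) :
    Matrix ((Fin m₁ ⊕ Fin m₂) ⊕ Fin n) ((Fin m₁ ⊕ Fin m₂) ⊕ Fin n) ℂ :=
  fromBlocks (fromBlocks A₁ 0 0 (-A₂)) (fromRows B₁ B₂) (fromCols B₁ᴴ B₂ᴴ) 0

/-- The matrix `N = [A₁, B₁, 0; B₁*, 0, B₂*]`. -/
def blockN {m₁ m₂ n : ℕ}
    (A₁ : Matrix (Fin m₁) (Fin m₁) ℂ) (B₁ : Matrix (Fin m₁) (Fin n) ℂ)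
    (B₂ : Matrix (Fin m₂) (Fin n) ℂ) :
    Matrix (Fin m₁ ⊕ Fin n) (Fin m₁ ⊕ (Fin n ⊕ Fin m₂)) ℂ :=
  fromBlocks A₁ (fromCols B₁ 0) B₁ᴴ (fromCols 0 B₂ᴴ)

end

/-! Inertia is treated variationally: `posDim` is the largest dimension of a subspace on which a
form is positive, so it makes sense on every subspace and not only on the whole space. The engine is
`posDim_orth_formula`, which splits the positive index of a Hermitian form along a subspace `K` and
its orthogonal, with a correction for the radical of `K`. Applied to a bordered matrix it gives
`posDim_fromBlocks`: i₊[A, B; B*, 0] = r(B) + i₊(A on ker B*).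

Write φ = A₁ - B₁XB₁* and S = A₂ - B₂XB₂* ≽ 0, K = ker B₁*, L for the A₁-orthogonal of K, and V for
the x with B₁*x ∈ R(B₂*). Neither L nor the form φ on K depends on X, and r[A₁,B₁], r[B₁;B₂] and
r(N) amount to the dimensions of L, V and V ∩ L. The matrix M enters through the form A₁ ⊕ -A₂ on
pairs (x, y) with B₁*x + B₂*y = 0; there it equals φ(x) - S(y) for every X
(`qform_fromBlocks_diagonal_of_mem_ker`), which ties its inertia to that of φ on V. The bounds
follow by comparing φ on the whole space, on V, on L and on V ∩ L.

For attainment, X - tI with t large maximizes rank and i₊. If X makes S of minimal rank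
(`exists_posSemidef_sub_mul_mul`), then X + tG with G ≽ 0, B₂G = 0 and t large maximizes i₋. From
the same kind of X one subtracts a Y that is nonnegative on R(B₂*) and makes φ nonnegative on L with
the smallest possible positive index (`exists_qform_orth_nonneg`); this single point minimizes i₊,
i₋ and hence the rank. The consequences (a)-(k) are then arithmetic. -/

open Module in
/-- The largest dimension of a subspace of `W` on which `q` is positive away from zero. -/
noncomputable def posDim {V : Type*} [AddCommGroup V] [Module ℂ V] (q : V → ℝ)
    (W : Submodule ℂ V) : ℕ :=
  sSup {d | ∃ P ≤ W, finrank ℂ P = d ∧ ∀ x ∈ P, x ≠ 0 → 0 < q x}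

/-! ### Positive index of a real function on subspaces. -/

section PosDim

open Module

variable {V V' : Type*} [AddCommGroup V] [Module ℂ V] [AddCommGroup V'] [Module ℂ V']

theorem finrank_map_add_finrank_inf_ker [FiniteDimensional ℂ V] (g : V →ₗ[ℂ] V')
    (W : Submodule ℂ V) :
    finrank ℂ (W.map g) + finrank ℂ (W ⊓ LinearMap.ker g : Submodule ℂ V) = finrank ℂ W := by
  have h := LinearMap.finrank_range_add_finrank_ker (g.domRestrict W)
  rw [LinearMap.range_domRestrict, LinearMap.ker_domRestrict] at h
  rw [← h, ← Submodule.finrank_map_subtype_eq W (Submodule.comap _ _),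
    Submodule.map_comap_subtype]

theorem finrank_add_le_of_le [FiniteDimensional ℂ V] {P N W : Submodule ℂ V} (hP : P ≤ W)
    (hN : N ≤ W) :
    finrank ℂ P + finrank ℂ N ≤ finrank ℂ W + finrank ℂ (P ⊓ N : Submodule ℂ V) := by
  rw [← Submodule.finrank_sup_add_finrank_inf_eq]
  exact Nat.add_le_add_right (Submodule.finrank_mono (sup_le hP hN)) _

variable {q : V → ℝ} {W W' P N : Submodule ℂ V}

theorem bddAbove_posDim [FiniteDimensional ℂ V] (q : V → ℝ) (W : Submodule ℂ V) :
    BddAbove {d | ∃ P ≤ W, finrank ℂ P = d ∧ ∀ x ∈ P, x ≠ 0 → 0 < q x} := by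
  refine ⟨finrank ℂ V, ?_⟩
  rintro d ⟨P, -, rfl, -⟩
  exact Submodule.finrank_le P

theorem exists_finrank_eq_posDim [FiniteDimensional ℂ V] (q : V → ℝ) (W : Submodule ℂ V) :
    ∃ P ≤ W, finrank ℂ P = posDim q W ∧ ∀ x ∈ P, x ≠ 0 → 0 < q x := by
  have hne : {d | ∃ P ≤ W, finrank ℂ P = d ∧ ∀ x ∈ P, x ≠ 0 → 0 < q x}.Nonempty :=
    ⟨0, ⊥, bot_le, finrank_bot ℂ V, fun _ hx h => absurd ((Submodule.mem_bot ℂ).1 hx) h⟩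
  exact Nat.sSup_mem hne (bddAbove_posDim q W)

theorem exists_compl_of_le {R P : Submodule ℂ V} (h : R ≤ P) :
    ∃ C ≤ P, R ⊓ C = ⊥ ∧ R ⊔ C = P := by
  obtain ⟨D, hD⟩ := Submodule.exists_isCompl R
  refine ⟨D ⊓ P, inf_le_right, ?_, ?_⟩
  · rw [← inf_assoc, hD.inf_eq_bot, bot_inf_eq]
  · rw [← sup_inf_assoc_of_le D h, hD.sup_eq_top, top_inf_eq]

theorem finrank_le_posDim [FiniteDimensional ℂ V] (hP : P ≤ W)
    (h : ∀ x ∈ P, x ≠ 0 → 0 < q x) : finrank ℂ P ≤ posDim q W :=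
  le_csSup (bddAbove_posDim q W) ⟨P, hP, rfl, h⟩

/-- A subspace where `q` is positive meets one where `q` is nonpositive only in zero. -/
theorem posDim_add_finrank_le [FiniteDimensional ℂ V] (hN : N ≤ W) (h : ∀ x ∈ N, q x ≤ 0) :
    posDim q W + finrank ℂ N ≤ finrank ℂ W := by
  obtain ⟨P, hPW, hP, hpos⟩ := exists_finrank_eq_posDim q W
  have h1 := finrank_add_le_of_le hPW hN
  have h2 : P ⊓ N = ⊥ := by
    rw [Submodule.eq_bot_iff]
    rintro x ⟨hx, hx'⟩
    by_contra h0
    exact absurd (hpos x hx h0) (not_lt.2 (h x hx'))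
  rw [h2, finrank_bot] at h1
  omega

theorem posDim_le_finrank [FiniteDimensional ℂ V] (q : V → ℝ) (W : Submodule ℂ V) :
    posDim q W ≤ finrank ℂ W := by
  obtain ⟨P, hPW, hP, -⟩ := exists_finrank_eq_posDim q W
  exact hP ▸ Submodule.finrank_mono hPW

theorem posDim_mono [FiniteDimensional ℂ V] (h : W' ≤ W) : posDim q W' ≤ posDim q W := by
  obtain ⟨P, hPW, hP, hpos⟩ := exists_finrank_eq_posDim q W'
  exact hP ▸ finrank_le_posDim (hPW.trans h) hpos

/-- Intersecting a positive subspace with `W'` loses at most the codimension of `W'` in `W`. -/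
theorem posDim_add_finrank_le_of_le [FiniteDimensional ℂ V] (q : V → ℝ) (h : W' ≤ W) :
    posDim q W + finrank ℂ W' ≤ posDim q W' + finrank ℂ W := by
  obtain ⟨P, hPW, hP, hpos⟩ := exists_finrank_eq_posDim q W
  have h1 := finrank_add_le_of_le hPW h
  have h2 : finrank ℂ (P ⊓ W' : Submodule ℂ V) ≤ posDim q W' :=
    finrank_le_posDim inf_le_right fun x hx => hpos x hx.1
  omega

/-- A map preserving positivity is injective on a positive subspace, since a kernel vector would
give `0 < q' 0`; no injectivity of `g` is needed. -/
theorem posDim_le_of_map [FiniteDimensional ℂ V] [FiniteDimensional ℂ V'] {q' : V' → ℝ}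
    (h0 : q' 0 = 0) (g : V →ₗ[ℂ] V') {W' : Submodule ℂ V'} (hg : ∀ x ∈ W, g x ∈ W')
    (h : ∀ x ∈ W, 0 < q x → 0 < q' (g x)) : posDim q W ≤ posDim q' W' := by
  obtain ⟨P, hPW, hP, hpos⟩ := exists_finrank_eq_posDim q W
  have h1 := finrank_map_add_finrank_inf_ker g P
  have h2 : P ⊓ LinearMap.ker g = ⊥ := by
    rw [Submodule.eq_bot_iff]
    rintro x ⟨hx, hx'⟩
    by_contra hne
    have := h x (hPW hx) (hpos x hx hne)
    rw [LinearMap.mem_ker.1 hx', h0] at this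
    exact lt_irrefl _ this
  rw [h2, finrank_bot, add_zero, hP] at h1
  rw [← h1]
  refine finrank_le_posDim ?_ ?_
  · rintro _ ⟨x, hx, rfl⟩
    exact hg x (hPW hx)
  · rintro _ ⟨x, hx, rfl⟩ hne
    exact h x (hPW hx) (hpos x hx fun hx0 => hne (by rw [hx0, map_zero]))

theorem posDim_congr {q' : V → ℝ} (h : ∀ x ∈ W, q x = q' x) : posDim q W = posDim q' W := by
  unfold posDim
  congr 1
  ext d
  constructor
  · rintro ⟨P, hPW, hP, hpos⟩
    exact ⟨P, hPW, hP, fun x hx hne => h x (hPW hx) ▸ hpos x hx hne⟩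
  · rintro ⟨P, hPW, hP, hpos⟩
    exact ⟨P, hPW, hP, fun x hx hne => (h x (hPW hx)).symm ▸ hpos x hx hne⟩

theorem posDim_eq_zero_of_nonpos [FiniteDimensional ℂ V] (h : ∀ x ∈ W, q x ≤ 0) :
    posDim q W = 0 := by
  have := posDim_add_finrank_le le_rfl h
  omega

end PosDim

/-! ### Hermitian forms, orthogonals and Sylvester's law on a subspace. -/

section HermitianForm

open Module

variable {ι : Type*} [Fintype ι]

/-- The sesquilinear form `x* A y`. -/
def hform (A : Matrix ι ι ℂ) (x y : ι → ℂ) : ℂ := star x ⬝ᵥ A *ᵥ y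

/-- The real part of `x* A x`. -/
def qform (A : Matrix ι ι ℂ) (x : ι → ℂ) : ℝ := (hform A x x).re

variable {A B : Matrix ι ι ℂ}

@[simp] theorem hform_add_left (A : Matrix ι ι ℂ) (x x' y : ι → ℂ) :
    hform A (x + x') y = hform A x y + hform A x' y := by
  simp [hform, add_dotProduct]

@[simp] theorem hform_add_right (A : Matrix ι ι ℂ) (x y y' : ι → ℂ) :
    hform A x (y + y') = hform A x y + hform A x y' := by
  simp [hform, mulVec_add, dotProduct_add]

@[simp] theorem hform_smul_left (A : Matrix ι ι ℂ) (c : ℂ) (x y : ι → ℂ) :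
    hform A (c • x) y = star c * hform A x y := by
  simp [hform, smul_dotProduct]

@[simp] theorem hform_smul_right (A : Matrix ι ι ℂ) (c : ℂ) (x y : ι → ℂ) :
    hform A x (c • y) = c * hform A x y := by
  simp [hform, mulVec_smul, dotProduct_smul]

@[simp] theorem hform_zero_left (A : Matrix ι ι ℂ) (y : ι → ℂ) : hform A 0 y = 0 := by
  simp [hform]

@[simp] theorem hform_zero_right (A : Matrix ι ι ℂ) (x : ι → ℂ) : hform A x 0 = 0 := by
  simp [hform]

@[simp] theorem hform_neg (A : Matrix ι ι ℂ) (x y : ι → ℂ) : hform (-A) x y = -hform A x y := by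
  simp [hform, neg_mulVec]

@[simp] theorem hform_add (A B : Matrix ι ι ℂ) (x y : ι → ℂ) :
    hform (A + B) x y = hform A x y + hform B x y := by
  simp [hform, add_mulVec]

@[simp] theorem hform_sub (A B : Matrix ι ι ℂ) (x y : ι → ℂ) :
    hform (A - B) x y = hform A x y - hform B x y := by
  simp [hform, sub_mulVec]

@[simp] theorem hform_smul (c : ℂ) (A : Matrix ι ι ℂ) (x y : ι → ℂ) :
    hform (c • A) x y = c * hform A x y := by
  simp [hform, smul_mulVec]

theorem hform_mul_mul {κ : Type*} [Fintype κ] (G : Matrix ι κ ℂ) (A : Matrix ι ι ℂ)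
    (x y : κ → ℂ) : hform (Gᴴ * A * G) x y = hform A (G *ᵥ x) (G *ᵥ y) := by
  simp only [hform, star_mulVec, ← mulVec_mulVec, dotProduct_mulVec, vecMul_vecMul]

theorem star_hform (hA : A.IsHermitian) (x y : ι → ℂ) : star (hform A x y) = hform A y x := by
  rw [hform, star_dotProduct, star_mulVec, hA.eq, hform, star_star, dotProduct_mulVec]

theorem hform_eq_zero_comm (hA : A.IsHermitian) {x y : ι → ℂ} (h : hform A x y = 0) :
    hform A y x = 0 := by
  rw [← star_hform hA, h, star_zero]

theorem hform_self (hA : A.IsHermitian) (x : ι → ℂ) : hform A x x = (qform A x : ℂ) :=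
  (Complex.conj_eq_iff_re.1 (star_hform hA x x)).symm

@[simp] theorem qform_zero (A : Matrix ι ι ℂ) : qform A 0 = 0 := by simp [qform]

@[simp] theorem qform_neg (A : Matrix ι ι ℂ) (x : ι → ℂ) : qform (-A) x = -qform A x := by
  simp [qform]

@[simp] theorem qform_add (A B : Matrix ι ι ℂ) (x : ι → ℂ) :
    qform (A + B) x = qform A x + qform B x := by
  simp [qform]

@[simp] theorem qform_sub (A B : Matrix ι ι ℂ) (x : ι → ℂ) :
    qform (A - B) x = qform A x - qform B x := by
  simp [qform]

@[simp] theorem qform_smul (t : ℝ) (A : Matrix ι ι ℂ) (x : ι → ℂ) :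
    qform ((t : ℂ) • A) x = t * qform A x := by
  rw [qform, hform_smul, Complex.re_ofReal_mul, qform]

theorem qform_mul_mul {κ : Type*} [Fintype κ] (G : Matrix ι κ ℂ) (A : Matrix ι ι ℂ)
    (x : κ → ℂ) : qform (Gᴴ * A * G) x = qform A (G *ᵥ x) := by
  rw [qform, hform_mul_mul, qform]

theorem qform_vec_smul (A : Matrix ι ι ℂ) (c : ℂ) (x : ι → ℂ) :
    qform A (c • x) = ‖c‖ ^ 2 * qform A x := by
  have : star c * c = ((‖c‖ ^ 2 : ℝ) : ℂ) := by
    simpa using Complex.conj_mul' c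
  rw [qform, hform_smul_right, hform_smul_left, ← mul_assoc, mul_comm c, this,
    Complex.re_ofReal_mul, qform]

theorem qform_add_of_hform_eq_zero (hA : A.IsHermitian) {x y : ι → ℂ} (h : hform A x y = 0) :
    qform A (x + y) = qform A x + qform A y := by
  simp [qform, h, hform_eq_zero_comm hA h]

theorem qform_add_eq (hA : A.IsHermitian) (x y : ι → ℂ) :
    qform A (x + y) = qform A x + qform A y + 2 * (hform A x y).re := by
  have : (hform A y x).re = (hform A x y).re := by rw [← star_hform hA]; simp
  simp [qform, this]; ring

theorem posSemidef_iff_qform_nonneg : A.PosSemidef ↔ A.IsHermitian ∧ ∀ x, 0 ≤ qform A x := by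
  rw [posSemidef_iff_dotProduct_mulVec]
  refine and_congr_right fun hA => forall_congr' fun x => ?_
  change 0 ≤ hform A x x ↔ _
  rw [hform_self hA, Complex.zero_le_real]

theorem posDef_iff_qform_pos : A.PosDef ↔ A.IsHermitian ∧ ∀ x, x ≠ 0 → 0 < qform A x := by
  rw [posDef_iff_dotProduct_mulVec]
  refine and_congr_right fun hA => forall_congr' fun x => imp_congr_right fun _ => ?_
  change 0 < hform A x x ↔ _
  rw [hform_self hA, Complex.zero_lt_real]

/-- The subspace of vectors orthogonal to `K` with respect to the form of `A`. -/
def orth (A : Matrix ι ι ℂ) (K : Submodule ℂ (ι → ℂ)) : Submodule ℂ (ι → ℂ) where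
  carrier := {x | ∀ k ∈ K, hform A k x = 0}
  add_mem' := fun hx hy k hk => by rw [hform_add_right, hx k hk, hy k hk, add_zero]
  zero_mem' := fun k _ => hform_zero_right A k
  smul_mem' := fun c x hx k hk => by rw [hform_smul_right, hx k hk, mul_zero]

variable {K W P : Submodule ℂ (ι → ℂ)}

theorem mem_orth {x : ι → ℂ} : x ∈ orth A K ↔ ∀ k ∈ K, hform A k x = 0 := Iff.rfl

@[simp] theorem orth_neg (A : Matrix ι ι ℂ) (K : Submodule ℂ (ι → ℂ)) :
    orth (-A) K = orth A K := by
  ext x; simp [mem_orth]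

/-- The pairing of `W` with `P` is annihilated by `P ⊓ orth A W`, so a basis of a complement `C` of
it in `P` supplies enough linear conditions to cut `W ⊓ orth A P` out of `W`. -/
theorem finrank_add_finrank_inf_orth_le (hA : A.IsHermitian) (W P : Submodule ℂ (ι → ℂ)) :
    finrank ℂ W + finrank ℂ (P ⊓ orth A W : Submodule ℂ (ι → ℂ)) ≤
      finrank ℂ (W ⊓ orth A P : Submodule ℂ (ι → ℂ)) + finrank ℂ P := by
  obtain ⟨C, hCle, hbot, hsup⟩ := exists_compl_of_le (inf_le_left : P ⊓ orth A W ≤ P)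
  have hCP := Submodule.finrank_sup_add_finrank_inf_eq (P ⊓ orth A W) C
  rw [hbot, hsup, finrank_bot, add_zero] at hCP
  let b := Module.finBasis ℂ C
  let g : (ι → ℂ) →ₗ[ℂ] (Fin (finrank ℂ C) → ℂ) :=
    { toFun := fun y i => hform A (b i : ι → ℂ) y
      map_add' := fun y y' => by ext; simp
      map_smul' := fun c y => by ext; simp }
  have h1 := finrank_map_add_finrank_inf_ker g W
  have h2 : finrank ℂ (W.map g) ≤ finrank ℂ C := by
    simpa using Submodule.finrank_le (W.map g)
  have h3 : finrank ℂ (W ⊓ LinearMap.ker g : Submodule ℂ (ι → ℂ)) ≤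
      finrank ℂ (W ⊓ orth A P : Submodule ℂ (ι → ℂ)) := by
    refine Submodule.finrank_mono ?_
    rintro y ⟨hyW, hy⟩
    refine ⟨hyW, fun k hk => ?_⟩
    let ℓ : C →ₗ[ℂ] ℂ :=
      { toFun := fun p => hform A y p
        map_add' := fun _ _ => by simp
        map_smul' := fun _ _ => by simp }
    have hℓ : ℓ = 0 := b.ext fun i =>
      hform_eq_zero_comm hA (congrFun (LinearMap.mem_ker.1 hy) i)
    rw [← hsup] at hk
    obtain ⟨u, hu, c, hc, rfl⟩ := Submodule.mem_sup.1 hk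
    have hc0 : hform A y c = 0 := LinearMap.congr_fun hℓ ⟨c, hc⟩
    rw [hform_add_left, hform_eq_zero_comm hA hc0, add_zero]
    exact hform_eq_zero_comm hA (hu.2 y hyW)
  omega

/-- Take a positive subspace of maximal dimension: a vector orthogonal to it with positive value
could be adjoined, contradicting maximality. -/
theorem exists_orth_decomposition (hA : A.IsHermitian) (W : Submodule ℂ (ι → ℂ)) :
    ∃ P ≤ W, finrank ℂ P = posDim (qform A) W ∧ (∀ x ∈ P, x ≠ 0 → 0 < qform A x) ∧
      (∀ x ∈ W ⊓ orth A P, qform A x ≤ 0) ∧ P ⊔ (W ⊓ orth A P) = W ∧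
      P ⊓ (W ⊓ orth A P) = ⊥ := by
  obtain ⟨P, hPW, hP, hpos⟩ := exists_finrank_eq_posDim (qform A) W
  have hbot : P ⊓ (W ⊓ orth A P) = ⊥ := by
    rw [Submodule.eq_bot_iff]
    rintro x ⟨hx, -, hx'⟩
    by_contra h0
    have h := hpos x hx h0
    rw [qform, hx' x hx] at h
    exact lt_irrefl _ h
  refine ⟨P, hPW, hP, hpos, ?_, ?_, hbot⟩
  · rintro v ⟨hvW, hv⟩
    by_contra! hlt
    have hv0 : v ≠ 0 := by rintro rfl; simp at hlt
    have hle : P ⊔ ℂ ∙ v ≤ W := sup_le hPW ((Submodule.span_singleton_le_iff_mem _ _).2 hvW)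
    have hsup : ∀ x ∈ P ⊔ ℂ ∙ v, x ≠ 0 → 0 < qform A x := by
      intro x hx hx0
      obtain ⟨p, hp, y, hy, rfl⟩ := Submodule.mem_sup.1 hx
      obtain ⟨c, rfl⟩ := Submodule.mem_span_singleton.1 hy
      rw [qform_add_of_hform_eq_zero hA (by rw [hform_smul_right, hv p hp, mul_zero]),
        qform_vec_smul]
      by_cases hp0 : p = 0
      · have hc : c ≠ 0 := by rintro rfl; simp [hp0] at hx0
        have : 0 < ‖c‖ := norm_pos_iff.2 hc
        rw [hp0, qform_zero, zero_add]
        positivity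
      · have := hpos p hp hp0
        positivity
    have h1 := finrank_le_posDim hle hsup
    have h2 := Submodule.finrank_sup_add_finrank_inf_eq P (ℂ ∙ v)
    have h3 : P ⊓ ℂ ∙ v ≤ P ⊓ (W ⊓ orth A P) := inf_le_inf_left _
      ((Submodule.span_singleton_le_iff_mem _ _).2 ⟨hvW, hv⟩)
    rw [hbot, le_bot_iff] at h3
    rw [h3, finrank_bot, finrank_span_singleton hv0] at h2
    omega
  · refine Submodule.eq_of_le_of_finrank_le (sup_le hPW inf_le_left) ?_
    have h1 := finrank_add_finrank_inf_orth_le hA W P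
    have h2 := Submodule.finrank_sup_add_finrank_inf_eq P (W ⊓ orth A P)
    rw [hbot, finrank_bot] at h2
    omega

theorem hform_eq_zero_of_qform_nonneg (hA : A.IsHermitian) (h : ∀ x ∈ W, 0 ≤ qform A x)
    {x y : ι → ℂ} (hx : x ∈ W) (hy : y ∈ W) (h0 : qform A x = 0) : hform A x y = 0 := by
  by_contra hne
  set c := hform A x y with hc
  have hcpos : 0 < ‖c‖ := norm_pos_iff.2 hne
  -- Expand the form at `-t c x + y`: as `x` is isotropic, the result is affine in `t`, and it
  -- cannot stay nonnegative.
  have key : ∀ t : ℝ, 0 ≤ qform A y - 2 * t * ‖c‖ ^ 2 := by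
    intro t
    have h1 := h _ (W.add_mem (W.smul_mem (-(t : ℂ) * c) hx) hy)
    rw [qform_add_eq hA, qform_vec_smul, h0, mul_zero, zero_add, hform_smul_left, ← hc] at h1
    have : star (-(t : ℂ) * c) * c = ((-(t * ‖c‖ ^ 2) : ℝ) : ℂ) := by
      have := Complex.conj_mul' c
      simp only [star_mul', star_neg, Complex.star_def, Complex.conj_ofReal]
      rw [mul_assoc, this]; push_cast; ring
    rw [this, Complex.ofReal_re] at h1
    linarith
  -- This `t` makes the right-hand side of `key` equal to -1.
  have := key ((qform A y + 1) / (2 * ‖c‖ ^ 2))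
  rw [mul_div_assoc', mul_comm 2 (qform A y + 1), div_mul_eq_mul_div, mul_assoc,
    mul_div_cancel_right₀ _ (by positivity)] at this
  linarith

/-- Sylvester's law on `W`: split off a maximal positive part, then a maximal negative part. What is
left is isotropic inside a semidefinite space, hence lies in the radical. -/
theorem posDim_add_posDim_neg_add (hA : A.IsHermitian) (W : Submodule ℂ (ι → ℂ)) :
    posDim (qform A) W + posDim (qform (-A)) W +
      finrank ℂ (W ⊓ orth A W : Submodule ℂ (ι → ℂ)) = finrank ℂ W := by
  apply le_antisymm
  · obtain ⟨P, hPW, hP, hpos⟩ := exists_finrank_eq_posDim (qform A) W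
    have h1 : ∀ x ∈ P ⊔ (W ⊓ orth A W), qform (-A) x ≤ 0 := by
      intro x hx
      obtain ⟨p, hp, r, hr, rfl⟩ := Submodule.mem_sup.1 hx
      have hrr : qform A r = 0 := by rw [qform, hr.2 r hr.1, Complex.zero_re]
      rw [qform_neg, qform_add_of_hform_eq_zero hA (hr.2 p (hPW hp)), hrr, add_zero,
        Left.neg_nonpos_iff]
      by_cases hp0 : p = 0
      · simp [hp0]
      · exact (hpos p hp hp0).le
    have h2 := posDim_add_finrank_le (sup_le hPW inf_le_left) h1
    have h3 := Submodule.finrank_sup_add_finrank_inf_eq P (W ⊓ orth A W)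
    have h4 : P ⊓ (W ⊓ orth A W) = ⊥ := by
      rw [Submodule.eq_bot_iff]
      rintro x ⟨hx, hxW, hx'⟩
      by_contra h0
      have h := hpos x hx h0
      rw [qform, hx' x hxW] at h
      exact lt_irrefl _ h
    rw [h4, finrank_bot] at h3
    omega
  · obtain ⟨P, hPW, hP, hpos, hneg, hsup, hbot⟩ := exists_orth_decomposition hA W
    set N := W ⊓ orth A P
    have hN : ∀ x ∈ N, 0 ≤ qform (-A) x := fun x hx => by simpa using hneg x hx
    obtain ⟨Q, hQN, hQ, hQpos, hQneg, hQsup, hQbot⟩ := exists_orth_decomposition hA.neg N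
    have hR : N ⊓ orth (-A) Q ≤ W ⊓ orth A W := by
      intro x hx
      refine ⟨hx.1.1, fun w hw => ?_⟩
      rw [← hsup] at hw
      obtain ⟨p, hp, y, hy, rfl⟩ := Submodule.mem_sup.1 hw
      have h0 : qform (-A) x = 0 := le_antisymm (hQneg x hx) (hN x hx.1)
      have h1 := hform_eq_zero_of_qform_nonneg hA.neg hN hx.1 hy h0
      rw [hform_neg, neg_eq_zero] at h1
      rw [hform_add_left, hform_eq_zero_comm hA h1, hx.1.2 p hp, add_zero]
    have h1 := Submodule.finrank_mono hR
    have h2 := Submodule.finrank_sup_add_finrank_inf_eq P N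
    have h3 := Submodule.finrank_sup_add_finrank_inf_eq Q (N ⊓ orth (-A) Q)
    have h4 : posDim (qform (-A)) N ≤ posDim (qform (-A)) W := posDim_mono inf_le_left
    rw [hsup, hbot, finrank_bot] at h2
    rw [hQsup, hQbot, finrank_bot] at h3
    omega

/-- The nonpositive parts of `K` and of its orthogonal in `W` are mutually orthogonal, so their sum
is nonpositive; they overlap only inside the radical of `K`. -/
theorem posDim_add_finrank_le_of_orth (hA : A.IsHermitian) (hKW : K ≤ W) :
    posDim (qform A) W + finrank ℂ K + finrank ℂ (W ⊓ orth A K : Submodule ℂ (ι → ℂ)) ≤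
      posDim (qform A) K + posDim (qform A) (W ⊓ orth A K) + finrank ℂ W +
        finrank ℂ (K ⊓ orth A K : Submodule ℂ (ι → ℂ)) := by
  obtain ⟨P, hPK, hP, -, hneg, hsup, hbot⟩ := exists_orth_decomposition hA K
  obtain ⟨Q, hQE, hQ, -, hQneg, hQsup, hQbot⟩ := exists_orth_decomposition hA (W ⊓ orth A K)
  set N := K ⊓ orth A P
  set E := W ⊓ orth A K
  set N' := E ⊓ orth A Q
  have h1 : ∀ x ∈ N ⊔ N', qform A x ≤ 0 := by
    intro x hx
    obtain ⟨y, hy, z, hz, rfl⟩ := Submodule.mem_sup.1 hx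
    rw [qform_add_of_hform_eq_zero hA (hz.1.2 y hy.1)]
    exact add_nonpos (hneg y hy) (hQneg z hz)
  have h2 := posDim_add_finrank_le
    (sup_le (inf_le_left.trans hKW) (inf_le_left.trans inf_le_left) : N ⊔ N' ≤ W) h1
  have h3 := Submodule.finrank_sup_add_finrank_inf_eq N N'
  have h4 : finrank ℂ (N ⊓ N' : Submodule ℂ (ι → ℂ)) ≤
      finrank ℂ (K ⊓ orth A K : Submodule ℂ (ι → ℂ)) :=
    Submodule.finrank_mono fun x hx => ⟨hx.1.1, hx.2.1.2⟩
  have h5 := Submodule.finrank_sup_add_finrank_inf_eq P N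
  have h6 := Submodule.finrank_sup_add_finrank_inf_eq Q N'
  rw [hsup, hbot, finrank_bot] at h5
  rw [hQsup, hQbot, finrank_bot] at h6
  omega

/-- The inertia of a Hermitian form on `W` in terms of that on a subspace `K` and on the
orthogonal of `K`. -/
theorem posDim_orth_formula (hA : A.IsHermitian) (hKW : K ≤ W) :
    posDim (qform A) W + finrank ℂ K + finrank ℂ (W ⊓ orth A K : Submodule ℂ (ι → ℂ)) =
      posDim (qform A) K + posDim (qform A) (W ⊓ orth A K) + finrank ℂ W +
        finrank ℂ (K ⊓ orth A K : Submodule ℂ (ι → ℂ)) := by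
  have h1 := posDim_add_finrank_le_of_orth hA hKW
  -- By Sylvester's law the bounds for `A` and `-A` add up to an inequality between dimensions of
  -- radicals. The counts below prove the opposite inequality, so both bounds are equalities.
  have h2 := posDim_add_finrank_le_of_orth hA.neg hKW
  rw [orth_neg] at h2
  have h3 := posDim_add_posDim_neg_add hA W
  have h4 := posDim_add_posDim_neg_add hA K
  have h5 := posDim_add_posDim_neg_add hA (W ⊓ orth A K)
  have h6 := finrank_add_finrank_inf_orth_le hA W K
  set E := W ⊓ orth A K
  set R := W ⊓ orth A W
  set K0 := K ⊓ orth A K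
  have h7 := Submodule.finrank_sup_add_finrank_inf_eq K0 R
  have h8 : finrank ℂ (K0 ⊔ R : Submodule ℂ (ι → ℂ)) ≤
      finrank ℂ (E ⊓ orth A E : Submodule ℂ (ι → ℂ)) := by
    refine Submodule.finrank_mono (sup_le ?_ ?_)
    · exact fun x hx => ⟨⟨hKW hx.1, hx.2⟩,
        fun e he => hform_eq_zero_comm hA (he.2 x hx.1)⟩
    · exact fun x hx => ⟨⟨hx.1, fun k hk => hx.2 k (hKW hk)⟩, fun e he => hx.2 e he.1⟩
  have h9 : finrank ℂ (K0 ⊓ R : Submodule ℂ (ι → ℂ)) ≤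
      finrank ℂ (K ⊓ orth A W : Submodule ℂ (ι → ℂ)) :=
    Submodule.finrank_mono fun x hx => ⟨hx.1.1, hx.2.2⟩
  omega

end HermitianForm

/-! ### Eigenvalue counts as positive indices. -/

section Spectral

open Module

variable {ι : Type*} [Fintype ι] [DecidableEq ι] {A : Matrix ι ι ℂ}

omit [DecidableEq ι] in
theorem finrank_iInf_ker_proj (S : Set ι) [DecidablePred (· ∈ S)] :
    finrank ℂ (⨅ i ∈ Sᶜ, LinearMap.ker (LinearMap.proj i : (ι → ℂ) →ₗ[ℂ] ℂ) :
      Submodule ℂ (ι → ℂ)) = Fintype.card S := by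
  rw [(LinearMap.iInfKerProjEquiv ℂ (fun _ : ι => ℂ) (I := S) (J := Sᶜ) disjoint_compl_right
    (Set.union_compl_self S).ge).finrank_eq, Module.finrank_fintype_fun_eq_card]

theorem qform_diagonal (d : ι → ℝ) (c : ι → ℂ) :
    qform (diagonal (RCLike.ofReal ∘ d)) c = ∑ i, d i * ‖c i‖ ^ 2 := by
  simp only [qform, hform, mulVec_diagonal, dotProduct, Complex.re_sum]
  refine Finset.sum_congr rfl fun i _ => ?_
  have : star c i * ((RCLike.ofReal ∘ d) i * c i) = ((d i * ‖c i‖ ^ 2 : ℝ) : ℂ) := by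
    have := Complex.conj_mul' (c i)
    simp only [Pi.star_apply, Complex.star_def, Function.comp_apply, Complex.coe_algebraMap]
    rw [mul_left_comm, this]
    simp
  rw [this, Complex.ofReal_re]

omit [DecidableEq ι] in
theorem posDim_sum_mul_norm_sq (d : ι → ℝ) :
    posDim (fun c : ι → ℂ => ∑ i, d i * ‖c i‖ ^ 2) ⊤ = Fintype.card {i // 0 < d i} := by
  classical
  set S : Set ι := {i | 0 < d i}
  have hmem : ∀ (T : Set ι) (x : ι → ℂ),
      x ∈ (⨅ i ∈ Tᶜ, LinearMap.ker (LinearMap.proj i : (ι → ℂ) →ₗ[ℂ] ℂ) :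
        Submodule ℂ (ι → ℂ)) ↔ ∀ i ∉ T, x i = 0 := by
    intro T x; simp [Submodule.mem_iInf]
  have hS : Fintype.card {i // 0 < d i} = Fintype.card S := rfl
  apply le_antisymm
  · have h1 : ∀ x ∈ (⨅ i ∈ (Sᶜ)ᶜ, LinearMap.ker (LinearMap.proj i : (ι → ℂ) →ₗ[ℂ] ℂ) :
        Submodule ℂ (ι → ℂ)), ∑ i, d i * ‖x i‖ ^ 2 ≤ 0 := by
      intro x hx
      rw [hmem] at hx
      refine Finset.sum_nonpos fun i _ => ?_
      by_cases hi : i ∈ S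
      · rw [hx i (by simpa using hi)]; simp
      · exact mul_nonpos_of_nonpos_of_nonneg (not_lt.1 hi) (by positivity)
    have h2 := posDim_add_finrank_le (q := fun c : ι → ℂ => ∑ i, d i * ‖c i‖ ^ 2) le_top h1
    rw [finrank_iInf_ker_proj, finrank_top, Module.finrank_fintype_fun_eq_card,
      Fintype.card_compl_set] at h2
    have h3 := Fintype.card_subtype_le (· ∈ S)
    have h4 : Fintype.card {x // x ∈ S} = Fintype.card S := rfl
    omega
  · rw [hS, ← finrank_iInf_ker_proj]
    refine finrank_le_posDim le_top fun x hx hx0 => ?_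
    rw [hmem] at hx
    obtain ⟨j, hj⟩ := Function.ne_iff.1 hx0
    have hjS : j ∈ S := by
      by_contra h
      exact hj (hx j h)
    refine Finset.sum_pos' (fun i _ => ?_) ⟨j, Finset.mem_univ j, ?_⟩
    · by_cases hi : i ∈ S
      · exact mul_nonneg (le_of_lt hi) (by positivity)
      · rw [hx i hi]; simp
    · have : 0 < ‖x j‖ := norm_pos_iff.2 hj
      exact mul_pos hjS (by positivity)

/-- Unitary diagonalization transports the form to a weighted sum of squares; `s = 1` and `s = -1`
give the two inertia indices. -/
theorem posDim_mul_qform (hA : A.IsHermitian) (s : ℝ) :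
    posDim (fun x => s * qform A x) ⊤ = Fintype.card {i // 0 < s * hA.eigenvalues i} := by
  rw [← posDim_sum_mul_norm_sq fun i => s * hA.eigenvalues i]
  obtain ⟨U, hD, hU⟩ : ∃ U : Matrix ι ι ℂ,
      Uᴴ * A * U = diagonal (RCLike.ofReal ∘ hA.eigenvalues) ∧ U * Uᴴ = 1 := by
    refine ⟨(hA.eigenvectorUnitary : Matrix ι ι ℂ), ?_,
      Unitary.coe_mul_star_self hA.eigenvectorUnitary⟩
    have := hA.conjStarAlgAut_star_eigenvectorUnitary
    rwa [Unitary.conjStarAlgAut_star_apply] at this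
  have key : ∀ c, qform A (U *ᵥ c) = ∑ i, hA.eigenvalues i * ‖c i‖ ^ 2 := by
    intro c
    rw [← qform_mul_mul, hD, qform_diagonal]
  have key' : ∀ c : ι → ℂ, s * qform A (U *ᵥ c) =
      ∑ i, s * hA.eigenvalues i * ‖c i‖ ^ 2 := by
    intro c
    rw [key, Finset.mul_sum]
    exact Finset.sum_congr rfl fun i _ => (mul_assoc _ _ _).symm
  apply le_antisymm
  · refine posDim_le_of_map (by simp) Uᴴ.mulVecLin (fun _ _ => trivial) fun x _ hx => ?_
    rw [mulVecLin_apply, ← key', mulVec_mulVec, hU, one_mulVec]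
    exact hx
  · refine posDim_le_of_map (by simp) U.mulVecLin (fun _ _ => trivial) fun x _ hx => ?_
    rw [mulVecLin_apply, key']
    exact hx

omit [DecidableEq ι] in
theorem card_filter_map_univ (p : ℂ → Prop) [DecidablePred p] (f : ι → ℂ) :
    Multiset.card ((Multiset.map f Finset.univ.val).filter p) = Fintype.card {i // p (f i)} := by
  rw [Multiset.filter_map, Multiset.card_map, Fintype.card_subtype]
  rfl

theorem posInertia_eq_posDim (hA : A.IsHermitian) : posInertia A = posDim (qform A) ⊤ := by
  classical
  have h := posDim_mul_qform hA 1
  simp only [one_mul] at h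
  have h' : posDim (qform A) ⊤ = _ := h
  rw [h', posInertia, hA.roots_charpoly_eq_eigenvalues, card_filter_map_univ]
  refine Fintype.card_congr (Equiv.subtypeEquivRight fun i => ?_)
  simp

theorem negInertia_eq_posDim (hA : A.IsHermitian) : negInertia A = posDim (qform (-A)) ⊤ := by
  classical
  have h := posDim_mul_qform hA (-1)
  simp only [neg_one_mul, ← qform_neg, Left.neg_pos_iff] at h
  have h' : posDim (qform (-A)) ⊤ = _ := h
  rw [h', negInertia, hA.roots_charpoly_eq_eigenvalues, card_filter_map_univ]
  refine Fintype.card_congr (Equiv.subtypeEquivRight fun i => ?_)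
  exact Complex.real_lt_real (y := 0)

end Spectral

/-! ### Ranks of block matrices as dimensions of preimages and orthogonals. -/

section Rank

open Module

variable {ι κ ν : Type*} [Fintype ι] [Fintype κ] [Fintype ν]

omit [Fintype ι] in
theorem rank_add_finrank_ker (B : Matrix ι κ ℂ) :
    B.rank + finrank ℂ (LinearMap.ker B.mulVecLin) = Fintype.card κ := by
  rw [Matrix.rank, LinearMap.finrank_range_add_finrank_ker, Module.finrank_fintype_fun_eq_card]

omit [Fintype ι] in
-- The preimage under `C` of the range of `D` maps onto the intersection of the two ranges with
-- kernel ker `C`; combine with the dimension formula for a sum.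
theorem rank_fromCols_add (C : Matrix ι κ ℂ) (D : Matrix ι ν ℂ) :
    (fromCols C D).rank +
      finrank ℂ ((LinearMap.range D.mulVecLin).comap C.mulVecLin) = Fintype.card κ + D.rank := by
  have hrange : LinearMap.range (fromCols C D).mulVecLin =
      LinearMap.range C.mulVecLin ⊔ LinearMap.range D.mulVecLin := by
    apply le_antisymm
    · rintro _ ⟨x, rfl⟩
      rw [mulVecLin_apply, fromCols_mulVec]
      exact Submodule.add_mem_sup ⟨_, rfl⟩ ⟨_, rfl⟩
    · refine sup_le ?_ ?_
      · rintro _ ⟨x, rfl⟩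
        exact ⟨Sum.elim x 0, by simp [fromCols_mulVec]⟩
      · rintro _ ⟨x, rfl⟩
        exact ⟨Sum.elim 0 x, by simp [fromCols_mulVec]⟩
  have h1 := Submodule.finrank_sup_add_finrank_inf_eq (LinearMap.range C.mulVecLin)
    (LinearMap.range D.mulVecLin)
  have h2 := finrank_map_add_finrank_inf_ker C.mulVecLin
    ((LinearMap.range D.mulVecLin).comap C.mulVecLin)
  rw [Submodule.map_comap_eq, inf_eq_right.2 (LinearMap.ker_le_comap _)] at h2
  have h3 := rank_add_finrank_ker C
  rw [← hrange] at h1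
  simp only [Matrix.rank] at *
  omega

omit [Fintype ι] [Fintype κ] in
theorem rank_fromRows_zero (B : Matrix κ ν ℂ) :
    (fromRows (0 : Matrix ι ν ℂ) B).rank = B.rank := by
  have h1 := rank_add_finrank_ker (fromRows (0 : Matrix ι ν ℂ) B)
  have h2 := rank_add_finrank_ker B
  have h3 : LinearMap.ker (fromRows (0 : Matrix ι ν ℂ) B).mulVecLin =
      LinearMap.ker B.mulVecLin := by
    ext x
    simp only [LinearMap.mem_ker, mulVecLin_apply, fromRows_mulVec, zero_mulVec]
    constructor
    · intro h
      ext i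
      exact congrFun h (Sum.inr i)
    · intro h
      rw [h]
      ext (i | i) <;> rfl
  rw [h3] at h1
  omega

omit [Fintype ι] [Fintype κ] in
theorem mem_range_fromRows_zero (B : Matrix κ ν ℂ) (x : ι → ℂ) (y : κ → ℂ) :
    Sum.elim x y ∈ LinearMap.range (fromRows (0 : Matrix ι ν ℂ) B).mulVecLin ↔
      x = 0 ∧ y ∈ LinearMap.range B.mulVecLin := by
  simp only [LinearMap.mem_range, mulVecLin_apply, fromRows_mulVec, zero_mulVec,
    Sum.elim_eq_iff]
  constructor
  · rintro ⟨z, h, h'⟩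
    exact ⟨h.symm, z, h'⟩
  · rintro ⟨h, z, h'⟩
    exact ⟨z, h.symm, h'⟩

omit [Fintype ι] in
theorem rank_fromBlocks_diagonal {ι' : Type*} [Fintype ι'] (B : Matrix ι κ ℂ)
    (C : Matrix ι' ν ℂ) : (fromBlocks B 0 0 C).rank = B.rank + C.rank := by
  rw [← fromCols_fromRows_eq_fromBlocks]
  have h1 := rank_fromCols_add (fromRows B (0 : Matrix ι' κ ℂ)) (fromRows (0 : Matrix ι ν ℂ) C)
  have h2 : (LinearMap.range (fromRows (0 : Matrix ι ν ℂ) C).mulVecLin).comap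
      (fromRows B (0 : Matrix ι' κ ℂ)).mulVecLin = LinearMap.ker B.mulVecLin := by
    ext x
    rw [Submodule.mem_comap, mulVecLin_apply, fromRows_mulVec, mem_range_fromRows_zero,
      zero_mulVec, LinearMap.mem_ker, mulVecLin_apply]
    exact and_iff_left (Submodule.zero_mem _)
  have h3 := rank_add_finrank_ker B
  rw [h2, rank_fromRows_zero] at h1
  omega

theorem star_dotProduct_mulVec_conjTranspose (B : Matrix ι κ ℂ) (x : ι → ℂ) (y : κ → ℂ) :
    star x ⬝ᵥ B *ᵥ y = star (Bᴴ *ᵥ x) ⬝ᵥ y := by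
  rw [star_mulVec, conjTranspose_conjTranspose, dotProduct_mulVec]

theorem mem_range_mulVecLin_iff (B : Matrix ι κ ℂ) (s : ι → ℂ) :
    s ∈ LinearMap.range B.mulVecLin ↔
      ∀ k ∈ LinearMap.ker Bᴴ.mulVecLin, star k ⬝ᵥ s = 0 := by
  classical
  constructor
  · rintro ⟨y, rfl⟩ k hk
    rw [mulVecLin_apply, star_dotProduct_mulVec_conjTranspose,
      show Bᴴ *ᵥ k = 0 from hk, star_zero, zero_dotProduct]
  · intro h
    by_contra hs
    obtain ⟨f, hf, hle⟩ := Submodule.exists_le_ker_of_notMem hs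
    set k : ι → ℂ := star fun i => f (Pi.single i 1)
    have hfk : ∀ x, f x = star k ⬝ᵥ x := by
      intro x
      rw [star_star]
      conv_lhs => rw [pi_eq_sum_univ' x, map_sum]
      refine Finset.sum_congr rfl fun i _ => ?_
      rw [map_smul, smul_eq_mul, mul_comm]
    refine hf ((hfk s).trans (h k ?_))
    rw [LinearMap.mem_ker, mulVecLin_apply, ← dotProduct_star_self_eq_zero]
    -- The functional `f` vanishes on the range of `B`; evaluated at `B Bᴴ k` it is the squared norm
    -- of `Bᴴ k`.
    have h2 : f (B *ᵥ (Bᴴ *ᵥ k)) = 0 := hle ⟨_, rfl⟩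
    rw [hfk, star_dotProduct_mulVec_conjTranspose] at h2
    exact h2

/-- The range of `B` is the annihilator of ker `Bᴴ`. This is how the rank of `[A, B]` comes to
measure the orthogonal of ker `Bᴴ`. -/
theorem comap_range_eq_orth (A : Matrix ι ι ℂ) (B : Matrix ι κ ℂ) :
    (LinearMap.range B.mulVecLin).comap A.mulVecLin = orth A (LinearMap.ker Bᴴ.mulVecLin) := by
  ext x
  rw [Submodule.mem_comap, mem_range_mulVecLin_iff]
  rfl

theorem orth_top (A : Matrix ι ι ℂ) : orth A ⊤ = LinearMap.ker A.mulVecLin := by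
  ext x
  rw [LinearMap.mem_ker, mulVecLin_apply]
  constructor
  · intro h
    exact dotProduct_star_self_eq_zero.1 (h (A *ᵥ x) trivial)
  · intro h k _
    rw [hform, h, dotProduct_zero]

theorem posDim_add_posDim_neg_top {A : Matrix ι ι ℂ} (hA : A.IsHermitian) :
    posDim (qform A) ⊤ + posDim (qform (-A)) ⊤ = A.rank := by
  have h1 := posDim_add_posDim_neg_add hA ⊤
  have h2 := rank_add_finrank_ker A
  rw [top_inf_eq, orth_top, finrank_top, Module.finrank_fintype_fun_eq_card] at h1
  omega

end Rank

/-! ### Inertia of bordered matrices. -/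

section Bordered

open Module

variable {ι κ : Type*} [Fintype ι] [Fintype κ]

theorem hform_fromBlocks (A : Matrix ι ι ℂ) (B : Matrix ι κ ℂ) (C : Matrix κ ι ℂ)
    (D : Matrix κ κ ℂ) (x y : ι ⊕ κ → ℂ) :
    hform (fromBlocks A B C D) x y =
      star (x ∘ Sum.inl) ⬝ᵥ (A *ᵥ (y ∘ Sum.inl) + B *ᵥ (y ∘ Sum.inr)) +
        star (x ∘ Sum.inr) ⬝ᵥ (C *ᵥ (y ∘ Sum.inl) + D *ᵥ (y ∘ Sum.inr)) := by
  rw [hform, fromBlocks_mulVec, dotProduct, Fintype.sum_sum_type]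
  rfl

/-- The inertia of a bordered matrix `[A, B; B*, 0]`. -/
theorem posDim_fromBlocks {A : Matrix ι ι ℂ} (hA : A.IsHermitian) (B : Matrix ι κ ℂ) :
    posDim (qform (fromBlocks A B Bᴴ 0)) ⊤ =
      B.rank + posDim (qform A) (LinearMap.ker Bᴴ.mulVecLin) := by
  set F := fromBlocks A B Bᴴ 0
  have hF : F.IsHermitian := hA.fromBlocks rfl isHermitian_zero
  let p : (ι ⊕ κ → ℂ) →ₗ[ℂ] (ι → ℂ) := LinearMap.funLeft ℂ ℂ Sum.inl
  let e : (ι → ℂ) →ₗ[ℂ] (ι ⊕ κ → ℂ) :=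
    { toFun := fun x => Sum.elim x 0
      map_add' := fun x y => by ext (i | i) <;> simp
      map_smul' := fun c x => by ext (i | i) <;> simp }
  have hpe : ∀ x, p (e x) = x := fun x => rfl
  -- `K` consists of the vectors (0, y). It is totally isotropic, and on its orthogonal, where `Bᴴ x
  -- = 0`, the form depends only on x and equals that of `A`; the orthogonal formula then gives the
  -- inertia.
  set K := LinearMap.ker p
  have hK : ∀ x, x ∈ K ↔ x ∘ Sum.inl = 0 := fun x => Iff.rfl
  have horth : orth F K = (LinearMap.ker Bᴴ.mulVecLin).comap p := by
    ext y
    rw [mem_orth, Submodule.mem_comap, LinearMap.mem_ker, mulVecLin_apply]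
    constructor
    · intro h
      have := h (Sum.elim 0 (Bᴴ *ᵥ (y ∘ Sum.inl))) ((hK _).2 (by simp))
      rw [hform_fromBlocks] at this
      simp only [Sum.elim_comp_inl, star_zero, zero_dotProduct, zero_add, Sum.elim_comp_inr,
        zero_mulVec, add_zero] at this
      exact dotProduct_star_self_eq_zero.1 this
    · intro h k hk
      have h' : Bᴴ *ᵥ (y ∘ Sum.inl) = 0 := h
      rw [hform_fromBlocks, (hK k).1 hk, h']
      simp
  have hKorth : K ≤ orth F K := by
    rw [horth]
    intro x hx
    rw [Submodule.mem_comap, LinearMap.mem_ker.1 hx]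
    exact Submodule.zero_mem _
  have hform0 : ∀ x ∈ orth F K, qform F x = qform A (p x) := by
    intro x hx
    rw [horth] at hx
    have h' : Bᴴ *ᵥ (x ∘ Sum.inl) = 0 := hx
    rw [qform, hform_fromBlocks, h', dotProduct_add, star_dotProduct_mulVec_conjTranspose B, h']
    simp [qform, hform, p, LinearMap.funLeft]
  have h1 := posDim_orth_formula hF (le_top : K ≤ ⊤)
  rw [top_inf_eq, inf_eq_left.2 hKorth, finrank_top] at h1
  have h2 : posDim (qform F) K = 0 := posDim_eq_zero_of_nonpos fun x hx => by
    rw [hform0 x (hKorth hx), LinearMap.mem_ker.1 hx, qform_zero]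
  have hsurj : Function.Surjective p := fun x => ⟨e x, hpe x⟩
  have h4 := finrank_map_add_finrank_inf_ker p ((LinearMap.ker Bᴴ.mulVecLin).comap p)
  rw [Submodule.map_comap_eq_of_surjective hsurj, inf_eq_right.2 (LinearMap.ker_le_comap _),
    ← horth] at h4
  have h5 := LinearMap.finrank_range_add_finrank_ker p
  rw [LinearMap.range_eq_top.2 hsurj, finrank_top, Module.finrank_fintype_fun_eq_card] at h5
  have h6 := rank_add_finrank_ker Bᴴ
  rw [rank_conjTranspose] at h6
  have h7 : posDim (qform F) (orth F K) = posDim (qform A) (LinearMap.ker Bᴴ.mulVecLin) := by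
    apply le_antisymm
    · refine posDim_le_of_map (qform_zero A) p (fun x hx => ?_) fun x hx h => ?_
      · rw [horth] at hx; exact hx
      · rwa [← hform0 x hx]
    · have he : ∀ x ∈ LinearMap.ker Bᴴ.mulVecLin, e x ∈ orth F K := by
        intro x hx
        rw [horth, Submodule.mem_comap, hpe]
        exact hx
      refine posDim_le_of_map (qform_zero F) e he fun x hx h => ?_
      rwa [hform0 _ (he x hx), hpe]
  omega

theorem posDim_neg_fromBlocks {A : Matrix ι ι ℂ} (hA : A.IsHermitian) (B : Matrix ι κ ℂ) :
    posDim (qform (-fromBlocks A B Bᴴ 0)) ⊤ =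
      B.rank + posDim (qform (-A)) (LinearMap.ker Bᴴ.mulVecLin) := by
  have h := posDim_fromBlocks hA.neg (-B)
  have h1 : LinearMap.ker (-B)ᴴ.mulVecLin = LinearMap.ker Bᴴ.mulVecLin := by
    ext x; simp
  have h2 := rank_add_finrank_ker (-B)ᴴ
  have h3 := rank_add_finrank_ker Bᴴ
  rw [rank_conjTranspose, h1] at h2
  rw [rank_conjTranspose] at h3
  rw [fromBlocks_neg, neg_zero, ← conjTranspose_neg, h, h1]
  omega

end Bordered

/-! ### Perturbation by a large positive semidefinite matrix. -/

section Perturbation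

open Module

variable {ι : Type*} [Fintype ι] {A G : Matrix ι ι ℂ} {W : Submodule ℂ (ι → ℂ)}

theorem continuous_qform (A : Matrix ι ι ℂ) : Continuous (qform A) := by
  unfold qform hform
  fun_prop

/-- Enlarge a maximal positive subspace of `W` by a complement of `W`. On the unit vectors of the
sum where `A` is not positive, `G` is positive, hence bounded below by compactness, so a large
multiple of `G` dominates. -/
theorem exists_posDim_add_smul (A : Matrix ι ι ℂ) (hG : ∀ x, 0 ≤ qform G x)
    (hW : ∀ x, qform G x = 0 → x ∈ W) :
    ∃ t : ℝ, 0 ≤ t ∧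
      posDim (qform A) W + Fintype.card ι ≤
        posDim (qform (A + (t : ℂ) • G)) ⊤ + finrank ℂ W := by
  obtain ⟨P, hPW, hP, hpos⟩ := exists_finrank_eq_posDim (qform A) W
  obtain ⟨C, hC⟩ := Submodule.exists_isCompl W
  set S := P ⊔ C
  have hSW : S ⊓ W = P := by
    rw [sup_inf_assoc_of_le C hPW, inf_comm, hC.inf_eq_bot, sup_bot_eq]
  have hdim : finrank ℂ S + finrank ℂ W = posDim (qform A) W + Fintype.card ι := by
    have h1 : finrank ℂ S + _ = _ := Submodule.finrank_sup_add_finrank_inf_eq P C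
    have h2 := Submodule.finrank_add_eq_of_isCompl hC
    have h3 : P ⊓ C = ⊥ := le_bot_iff.1 ((inf_le_inf_right C hPW).trans hC.inf_eq_bot.le)
    rw [h3, finrank_bot] at h1
    rw [Module.finrank_fintype_fun_eq_card] at h2
    omega
  set Q : Set (ι → ℂ) := Metric.sphere 0 1 ∩ (S ∩ {x | qform A x ≤ 0})
  have hQ : IsCompact Q := (isCompact_sphere _ _).inter_right
    ((Submodule.closed_of_finiteDimensional S).inter
      (isClosed_le (continuous_qform A) continuous_const))
  have hQpos : ∀ x ∈ Q, 0 < qform G x := by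
    rintro x ⟨hx1, hxS, hx0⟩
    refine lt_of_le_of_ne (hG x) fun h => ?_
    have hxP : x ∈ P := hSW ▸ ⟨hxS, hW x h.symm⟩
    have hx : x ≠ 0 := by rintro rfl; simp at hx1
    exact absurd (hpos x hxP hx) (not_lt.2 hx0)
  obtain ⟨t, ht, htQ⟩ : ∃ t : ℝ, 0 ≤ t ∧ ∀ x ∈ Q, 0 < qform A x + t * qform G x := by
    rcases Q.eq_empty_or_nonempty with hE | hne
    · exact ⟨0, le_rfl, fun x hx => by simp [hE] at hx⟩
    · obtain ⟨y, hy, hymin⟩ := hQ.exists_isMinOn hne (continuous_qform G).continuousOn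
      obtain ⟨z, hz, hzmin⟩ := hQ.exists_isMinOn hne (continuous_qform A).continuousOn
      have hδ := hQpos y hy
      have hz0 : qform A z ≤ 0 := hz.2.2
      -- With `z` and `y` minimizing the two forms on `Q`, this multiple makes the sum at least 1
      -- throughout `Q`.
      have ht : 0 ≤ (1 - qform A z) / qform G y := div_nonneg (by linarith) hδ.le
      refine ⟨(1 - qform A z) / qform G y, ht, fun x hx => ?_⟩
      have h1 : qform G y ≤ qform G x := hymin hx
      have h2 : qform A z ≤ qform A x := hzmin hx
      have h3 := mul_le_mul_of_nonneg_left h1 ht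
      rw [div_mul_cancel₀ _ hδ.ne'] at h3
      linarith
  refine ⟨t, ht, ?_⟩
  rw [← hdim]
  refine Nat.add_le_add_right (finrank_le_posDim le_top fun x hx hx0 => ?_) _
  have hnorm : 0 < ‖x‖ := norm_pos_iff.2 hx0
  set y : ι → ℂ := ((‖x‖⁻¹ : ℝ) : ℂ) • x
  have hyS : y ∈ S := S.smul_mem _ hx
  have hy1 : y ∈ Metric.sphere (0 : ι → ℂ) 1 := by
    simp [y, norm_smul, hnorm.ne']
  have hy : 0 < qform (A + (t : ℂ) • G) y := by
    rw [qform_add, qform_smul]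
    by_cases h : qform A y ≤ 0
    · exact htQ y ⟨hy1, hyS, h⟩
    · exact add_pos_of_pos_of_nonneg (not_le.1 h) (mul_nonneg ht (hG y))
  rw [qform_vec_smul] at hy
  exact pos_of_mul_pos_right hy (by positivity)

end Perturbation

/-! ### Projections and partial sections. -/

section LinearMaps

open Module

variable {V V' : Type*} [AddCommGroup V] [Module ℂ V] [AddCommGroup V'] [Module ℂ V']

theorem exists_projection_of_inf_eq_bot {P N : Submodule ℂ V} (h : P ⊓ N = ⊥) :
    ∃ π : V →ₗ[ℂ] V, (∀ x, π x ∈ P) ∧ (∀ x ∈ P, π x = x) ∧ ∀ x ∈ N, π x = 0 := by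
  obtain ⟨G, hNG, hG⟩ := (disjoint_iff.2 h).symm.exists_isCompl
  exact ⟨P.projection G hG.symm, fun x => Submodule.projection_apply_mem _ x,
    fun x hx => Submodule.projection_apply_of_mem_left _ hx,
    fun x hx => (Submodule.projection_apply_eq_zero_iff _).2 (hNG hx)⟩

/-- Project so as to kill a complement of `S ⊓ U` chosen inside `U`. -/
theorem exists_projection_map_le (S U : Submodule ℂ V) :
    ∃ ρ : V →ₗ[ℂ] V, (∀ x, ρ x ∈ S) ∧ (∀ x ∈ S, ρ x = x) ∧ ∀ x ∈ U, ρ x ∈ U := by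
  obtain ⟨C, hCU, hbot, hsup⟩ := exists_compl_of_le (inf_le_right : S ⊓ U ≤ U)
  have hSC : S ⊓ C = ⊥ := by
    rw [← hbot, inf_assoc, inf_eq_right.2 hCU]
  obtain ⟨ρ, h1, h2, h3⟩ := exists_projection_of_inf_eq_bot hSC
  refine ⟨ρ, h1, h2, fun x hx => ?_⟩
  rw [← hsup] at hx
  obtain ⟨y, hy, c, hc, rfl⟩ := Submodule.mem_sup.1 hx
  rw [map_add, h2 y hy.1, h3 c hc, add_zero]
  exact hy.2

theorem exists_section_on_map (g : V →ₗ[ℂ] V') (E : Submodule ℂ V) :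
    ∃ s : V' →ₗ[ℂ] V, (∀ w, s w ∈ E) ∧ ∀ w ∈ E.map g, g (s w) = w := by
  obtain ⟨r, hr⟩ := (g.domRestrict E).rangeRestrict.exists_rightInverse_of_surjective
    (LinearMap.range_rangeRestrict _)
  obtain ⟨s, hs⟩ := LinearMap.exists_extend r
  refine ⟨E.subtype ∘ₗ s, fun w => (s w).2, fun w hw => ?_⟩
  have hw' : w ∈ LinearMap.range (g.domRestrict E) := by
    rwa [LinearMap.range_domRestrict]
  have h1 : s w = r ⟨w, hw'⟩ := LinearMap.congr_fun hs ⟨w, hw'⟩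
  have h2 := congrArg Subtype.val (LinearMap.congr_fun hr ⟨w, hw'⟩)
  change g (s w : V) = w
  rw [h1]
  exact h2

end LinearMaps

/-! ### Dependence of `A - B X Bᴴ` on `X`. -/

section Forms

open Module

variable {ι κ ν : Type*} [Fintype ι] [Fintype κ] [Fintype ν]

theorem hform_mul_mul_conjTranspose (B : Matrix ι ν ℂ) (X : Matrix ν ν ℂ) (x y : ι → ℂ) :
    hform (B * X * Bᴴ) x y = hform X (Bᴴ *ᵥ x) (Bᴴ *ᵥ y) := by
  have := hform_mul_mul Bᴴ X x y
  rwa [conjTranspose_conjTranspose] at this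

theorem qform_mul_mul_conjTranspose (B : Matrix ι ν ℂ) (X : Matrix ν ν ℂ) (x : ι → ℂ) :
    qform (B * X * Bᴴ) x = qform X (Bᴴ *ᵥ x) := by
  rw [qform, hform_mul_mul_conjTranspose, qform]

omit [Fintype ι] in
theorem isHermitian_sub_mul_mul {A : Matrix ι ι ℂ} (hA : A.IsHermitian) (B : Matrix ι ν ℂ)
    {X : Matrix ν ν ℂ} (hX : X.IsHermitian) : (A - B * X * Bᴴ).IsHermitian :=
  hA.sub (isHermitian_mul_mul_conjTranspose B hX)

theorem hform_sub_mul_mul_of_mem_ker (A : Matrix ι ι ℂ) (B : Matrix ι ν ℂ) (X : Matrix ν ν ℂ)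
    {k : ι → ℂ} (hk : k ∈ LinearMap.ker Bᴴ.mulVecLin) (x : ι → ℂ) :
    hform (A - B * X * Bᴴ) k x = hform A k x := by
  rw [hform_sub, hform_mul_mul_conjTranspose, show Bᴴ *ᵥ k = 0 from hk, hform_zero_left, sub_zero]

/-- Pairings with ker `Bᴴ` do not see `X`, so this orthogonal is common to all `X`. -/
theorem orth_sub_mul_mul (A : Matrix ι ι ℂ) (B : Matrix ι ν ℂ) (X : Matrix ν ν ℂ) :
    orth (A - B * X * Bᴴ) (LinearMap.ker Bᴴ.mulVecLin) =
      orth A (LinearMap.ker Bᴴ.mulVecLin) := by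
  ext x
  exact forall₂_congr fun k hk => by rw [hform_sub_mul_mul_of_mem_ker A B X hk]

theorem posDim_sub_mul_mul_ker (A : Matrix ι ι ℂ) (B : Matrix ι ν ℂ) (X : Matrix ν ν ℂ) :
    posDim (qform (A - B * X * Bᴴ)) (LinearMap.ker Bᴴ.mulVecLin) =
      posDim (qform A) (LinearMap.ker Bᴴ.mulVecLin) :=
  posDim_congr fun x hx => by rw [qform, hform_sub_mul_mul_of_mem_ker A B X hx, qform]

theorem posDim_neg_sub_mul_mul_ker (A : Matrix ι ι ℂ) (B : Matrix ι ν ℂ) (X : Matrix ν ν ℂ) :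
    posDim (qform (-(A - B * X * Bᴴ))) (LinearMap.ker Bᴴ.mulVecLin) =
      posDim (qform (-A)) (LinearMap.ker Bᴴ.mulVecLin) :=
  posDim_congr fun x hx => by
    rw [qform_neg, qform_neg, qform, hform_sub_mul_mul_of_mem_ker A B X hx, qform]

theorem qform_nonpos_of_posDim_eq_zero {A : Matrix ι ι ℂ} {W : Submodule ℂ (ι → ℂ)}
    (h : posDim (qform A) W = 0) : ∀ x ∈ W, qform A x ≤ 0 := by
  intro x hx
  by_contra! hlt
  have hx0 : x ≠ 0 := by rintro rfl; simp at hlt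
  have h1 : finrank ℂ (ℂ ∙ x) ≤ posDim (qform A) W := by
    refine finrank_le_posDim ((Submodule.span_singleton_le_iff_mem _ _).2 hx) ?_
    intro y hy hy0
    obtain ⟨c, rfl⟩ := Submodule.mem_span_singleton.1 hy
    have : 0 < ‖c‖ := norm_pos_iff.2 fun hc => hy0 (by rw [hc, zero_smul])
    rw [qform_vec_smul]
    positivity
  rw [finrank_span_singleton hx0, h] at h1
  omega

theorem mulVec_eq_zero_of_qform_eq_zero {S : Matrix ι ι ℂ} (hS : S.IsHermitian)
    (h : ∀ x, 0 ≤ qform S x) {x : ι → ℂ} (hx : qform S x = 0) : S *ᵥ x = 0 := by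
  have hx' : x ∈ orth S ⊤ := fun k _ =>
    hform_eq_zero_comm hS (hform_eq_zero_of_qform_nonneg hS (W := ⊤) (fun x _ => h x)
      trivial trivial hx)
  rwa [orth_top] at hx'

end Forms

/-! ### Solvability of `B X Bᴴ ≼ A`. -/

section Consistency

open Module

variable {κ ν : Type*} [Fintype κ] [Fintype ν] {A : Matrix κ κ ℂ} {B : Matrix κ ν ℂ}

/-- For a semidefinite form, isotropic vectors lie in the kernel. Hence the radical of ker `Bᴴ` is
orthogonal to the whole space, which forces equality in the dimension count. -/
theorem posDim_ker_add_finrank_orth_of_posSemidef {X : Matrix ν ν ℂ}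
    (hA : A.IsHermitian) (hX : X.IsHermitian)
    (hS : (A - B * X * Bᴴ).PosSemidef) :
    posDim (qform A) (LinearMap.ker Bᴴ.mulVecLin) +
      finrank ℂ (orth A (LinearMap.ker Bᴴ.mulVecLin)) = Fintype.card κ := by
  have hSH := isHermitian_sub_mul_mul hA B hX
  have hS0 := (posSemidef_iff_qform_nonneg.1 hS).2
  rw [← posDim_sub_mul_mul_ker A B X, ← orth_sub_mul_mul A B X]
  set S := A - B * X * Bᴴ
  set K := LinearMap.ker Bᴴ.mulVecLin
  have h1 := posDim_add_posDim_neg_add hSH K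
  have h2 : posDim (qform (-S)) K = 0 :=
    posDim_eq_zero_of_nonpos fun x _ => by simpa using hS0 x
  have h3 : K ⊓ orth S K ≤ K ⊓ orth S ⊤ := by
    rintro x ⟨hxK, hx⟩
    refine ⟨hxK, ?_⟩
    rw [orth_top]
    exact mulVec_eq_zero_of_qform_eq_zero hSH hS0 (by rw [qform, hx x hxK, Complex.zero_re])
  have h4 := Submodule.finrank_mono h3
  have h5 := finrank_add_finrank_inf_orth_le hSH ⊤ K
  have h6 := finrank_add_le_of_le (le_top : K ≤ ⊤) (le_top : orth S K ≤ ⊤)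
  rw [top_inf_eq, finrank_top, Module.finrank_fintype_fun_eq_card] at h5
  rw [finrank_top, Module.finrank_fintype_fun_eq_card] at h6
  omega

/-- If the rank condition holds, `A - B X B*` can be made positive semidefinite of
minimal rank. -/
theorem exists_posSemidef_sub_mul_mul (hA : A.IsHermitian)
    (h : posDim (qform A) (LinearMap.ker Bᴴ.mulVecLin) +
      finrank ℂ (orth A (LinearMap.ker Bᴴ.mulVecLin)) = Fintype.card κ) :
    ∃ X : Matrix ν ν ℂ, X.IsHermitian ∧ (A - B * X * Bᴴ).PosSemidef ∧
      (A - B * X * Bᴴ).rank ≤ posDim (qform A) (LinearMap.ker Bᴴ.mulVecLin) ∧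
      LinearMap.ker Bᴴ.mulVecLin ⊔ LinearMap.ker (A - B * X * Bᴴ).mulVecLin = ⊤ := by
  classical
  set K := LinearMap.ker Bᴴ.mulVecLin with hKdef
  set L := orth A K
  have h1 : _ + _ + finrank ℂ (K ⊓ L : Submodule ℂ (κ → ℂ)) = _ :=
    posDim_add_posDim_neg_add hA K
  have h2 := finrank_add_le_of_le (le_top : K ≤ ⊤) (le_top : L ≤ ⊤)
  have h3 := Submodule.finrank_sup_add_finrank_inf_eq K L
  rw [finrank_top, Module.finrank_fintype_fun_eq_card] at h2
  -- The hypothesis leaves no room for a negative part of `A` on `K`, and makes `K` and `L` span.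
  have hneg : posDim (qform (-A)) K = 0 := by omega
  have hsup : K ⊔ L = ⊤ := by
    refine Submodule.eq_top_of_finrank_eq ?_
    have h4 := Submodule.finrank_le (K ⊔ L)
    rw [Module.finrank_fintype_fun_eq_card] at h4 ⊢
    omega
  have hK : ∀ k ∈ K, 0 ≤ qform A k := fun k hk => by
    simpa using qform_nonpos_of_posDim_eq_zero hneg k hk
  -- `X` is the form of `A` on `L` transported to `Bᴴ L` by a section, so that subtracting it kills
  -- the form on `L` and leaves `A` on `K`. The section is determined up to `K ⊓ L`, which
  -- contributes nothing.
  obtain ⟨s, hsL, hs⟩ := exists_section_on_map Bᴴ.mulVecLin L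
  set P := LinearMap.toMatrix' s
  have hP : ∀ w, P *ᵥ w = s w := fun w => LinearMap.toMatrix'_mulVec s w
  have hX : (Pᴴ * A * P).IsHermitian := isHermitian_conjTranspose_mul_mul P hA
  set S := A - B * (Pᴴ * A * P) * Bᴴ with hSdef
  have hSH : S.IsHermitian := isHermitian_sub_mul_mul hA B hX
  have hS : ∀ k ∈ K, ∀ e ∈ L, qform S (k + e) = qform A k := by
    intro k hk e he
    have hk0 : Bᴴ *ᵥ k = 0 := hk
    have hse : Bᴴ *ᵥ s (Bᴴ *ᵥ e) = Bᴴ *ᵥ e := hs _ ⟨e, he, rfl⟩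
    set k' := s (Bᴴ *ᵥ e) - e with hk'def
    have hk'K : k' ∈ K := by
      rw [hKdef, LinearMap.mem_ker, mulVecLin_apply, hk'def, mulVec_sub, hse, sub_self]
    have hk'L : k' ∈ L := L.sub_mem (hsL _) he
    have hk'0 : qform A k' = 0 := by rw [qform, hk'L k' hk'K, Complex.zero_re]
    have hsk : s (Bᴴ *ᵥ e) = k' + e := by rw [hk'def, sub_add_cancel]
    rw [hSdef, qform_sub, qform_mul_mul_conjTranspose, mulVec_add, hk0, zero_add, qform_mul_mul,
      hP, hsk, qform_add_of_hform_eq_zero hA (he k hk),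
      qform_add_of_hform_eq_zero hA (he k' hk'K), hk'0]
    ring
  have hS0 : ∀ x, 0 ≤ qform S x := by
    intro x
    have hx : x ∈ K ⊔ L := hsup ▸ Submodule.mem_top
    obtain ⟨k, hk, e, he, rfl⟩ := Submodule.mem_sup.1 hx
    rw [hS k hk e he]
    exact hK k hk
  have hker : L ≤ LinearMap.ker S.mulVecLin := by
    intro e he
    have h0 := hS 0 K.zero_mem e he
    rw [zero_add, qform_zero] at h0
    exact mulVec_eq_zero_of_qform_eq_zero hSH hS0 h0
  refine ⟨_, hX, posSemidef_iff_qform_nonneg.2 ⟨hSH, hS0⟩, ?_,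
    top_unique (hsup.ge.trans (sup_le_sup_left hker K))⟩
  have h5 := Submodule.finrank_mono hker
  have h6 := rank_add_finrank_ker S
  change S.rank ≤ _
  omega

end Consistency

/-! ### Comparison with the form `A₁ ⊕ -A₂` on the kernel of `[B₁; B₂]ᴴ`, and the auxiliary
perturbations. -/

section Constrained

open Module

variable {ι κ ν : Type*} [Fintype ι] [Fintype κ] [Fintype ν]
  {A₁ : Matrix ι ι ℂ} {B₁ : Matrix ι ν ℂ} {A₂ : Matrix κ κ ℂ} {B₂ : Matrix κ ν ℂ}
  {X : Matrix ν ν ℂ}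

omit [Fintype ν] in
theorem mem_ker_conjTranspose_fromRows (z : ι ⊕ κ → ℂ) :
    z ∈ LinearMap.ker (fromRows B₁ B₂)ᴴ.mulVecLin ↔
      B₁ᴴ *ᵥ (z ∘ Sum.inl) + B₂ᴴ *ᵥ (z ∘ Sum.inr) = 0 := by
  rw [LinearMap.mem_ker, mulVecLin_apply, conjTranspose_fromRows_eq_fromCols_conjTranspose,
    fromCols_mulVec]

omit [Fintype ν] in
theorem comp_inl_mem_of_mem_ker {z : ι ⊕ κ → ℂ}
    (hz : z ∈ LinearMap.ker (fromRows B₁ B₂)ᴴ.mulVecLin) :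
    z ∘ Sum.inl ∈ (LinearMap.range B₂ᴴ.mulVecLin).comap B₁ᴴ.mulVecLin := by
  rw [mem_ker_conjTranspose_fromRows] at hz
  refine ⟨-(z ∘ Sum.inr), ?_⟩
  rw [mulVecLin_apply, mulVec_neg, mulVecLin_apply]
  exact (eq_neg_of_add_eq_zero_left hz).symm

/-- On this kernel `B₁ᴴ x = -B₂ᴴ y`, so the two terms containing `X` cancel. -/
theorem qform_fromBlocks_diagonal_of_mem_ker {z : ι ⊕ κ → ℂ}
    (hz : z ∈ LinearMap.ker (fromRows B₁ B₂)ᴴ.mulVecLin) (X : Matrix ν ν ℂ) :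
    qform (fromBlocks A₁ 0 0 (-A₂)) z =
      qform (A₁ - B₁ * X * B₁ᴴ) (z ∘ Sum.inl) - qform (A₂ - B₂ * X * B₂ᴴ) (z ∘ Sum.inr) := by
  rw [mem_ker_conjTranspose_fromRows] at hz
  have h1 : B₁ᴴ *ᵥ (z ∘ Sum.inl) = (-1 : ℂ) • (B₂ᴴ *ᵥ (z ∘ Sum.inr)) := by
    rw [neg_one_smul]; exact eq_neg_of_add_eq_zero_left hz
  have h2 : qform (fromBlocks A₁ 0 0 (-A₂)) z =
      qform A₁ (z ∘ Sum.inl) - qform A₂ (z ∘ Sum.inr) := by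
    rw [qform, hform_fromBlocks]
    simp only [zero_mulVec, add_zero, zero_add]
    rw [Complex.add_re, sub_eq_add_neg, ← qform_neg]
    rfl
  rw [h2, qform_sub, qform_sub, qform_mul_mul_conjTranspose, qform_mul_mul_conjTranspose, h1,
    qform_vec_smul]
  simp

theorem posDim_ker_le_of_posSemidef (hS : ∀ y, 0 ≤ qform (A₂ - B₂ * X * B₂ᴴ) y) :
    posDim (qform (fromBlocks A₁ 0 0 (-A₂))) (LinearMap.ker (fromRows B₁ B₂)ᴴ.mulVecLin) ≤
      posDim (qform (A₁ - B₁ * X * B₁ᴴ))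
        ((LinearMap.range B₂ᴴ.mulVecLin).comap B₁ᴴ.mulVecLin) := by
  refine posDim_le_of_map (qform_zero _) (LinearMap.funLeft ℂ ℂ Sum.inl)
    (fun z hz => comp_inl_mem_of_mem_ker hz) fun z hz h => ?_
  rw [qform_fromBlocks_diagonal_of_mem_ker hz X] at h
  have := hS (z ∘ Sum.inr)
  change 0 < qform _ (z ∘ Sum.inl)
  linarith

/-- The spanning hypothesis allows `y` to be chosen linearly in ker `S`, where `S = A₂ - B₂ X B₂ᴴ`;
then `S` contributes nothing at (x, y). -/
theorem posDim_le_posDim_ker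
    (hS : LinearMap.ker B₂ᴴ.mulVecLin ⊔ LinearMap.ker (A₂ - B₂ * X * B₂ᴴ).mulVecLin = ⊤) :
    posDim (qform (A₁ - B₁ * X * B₁ᴴ))
        ((LinearMap.range B₂ᴴ.mulVecLin).comap B₁ᴴ.mulVecLin) ≤
      posDim (qform (fromBlocks A₁ 0 0 (-A₂))) (LinearMap.ker (fromRows B₁ B₂)ᴴ.mulVecLin) := by
  obtain ⟨s, hsker, hs⟩ := exists_section_on_map B₂ᴴ.mulVecLin
    (LinearMap.ker (A₂ - B₂ * X * B₂ᴴ).mulVecLin)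
  let e : (ι → ℂ) →ₗ[ℂ] (ι ⊕ κ → ℂ) :=
    { toFun := fun x => Sum.elim x (-s (B₁ᴴ *ᵥ x))
      map_add' := fun x y => by
        ext (i | i)
        · simp
        · simp [mulVec_add]; ring
      map_smul' := fun c x => by
        ext (i | i)
        · simp
        · simp [mulVec_smul] }
  have hel : ∀ x, e x ∘ Sum.inl = x := fun _ => rfl
  have her : ∀ x, e x ∘ Sum.inr = -s (B₁ᴴ *ᵥ x) := fun _ => rfl
  have he : ∀ x ∈ (LinearMap.range B₂ᴴ.mulVecLin).comap B₁ᴴ.mulVecLin,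
      e x ∈ LinearMap.ker (fromRows B₁ B₂)ᴴ.mulVecLin := by
    rintro x ⟨y, hy⟩
    have hy' : y ∈ LinearMap.ker B₂ᴴ.mulVecLin ⊔
        LinearMap.ker (A₂ - B₂ * X * B₂ᴴ).mulVecLin := hS ▸ Submodule.mem_top
    obtain ⟨u, hu, v, hv, rfl⟩ := Submodule.mem_sup.1 hy'
    rw [map_add, LinearMap.mem_ker.1 hu, zero_add] at hy
    have hsx := hs (B₁ᴴ *ᵥ x) ⟨v, hv, hy⟩
    rw [mulVecLin_apply] at hsx
    rw [mem_ker_conjTranspose_fromRows, hel, her, mulVec_neg, hsx, add_neg_cancel]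
  refine posDim_le_of_map (qform_zero _) e he fun x hx h => ?_
  have h0 : (A₂ - B₂ * X * B₂ᴴ) *ᵥ (-s (B₁ᴴ *ᵥ x)) = 0 := by
    rw [mulVec_neg, show (A₂ - B₂ * X * B₂ᴴ) *ᵥ s (B₁ᴴ *ᵥ x) = 0 from hsker _, neg_zero]
  have h1 : qform (A₂ - B₂ * X * B₂ᴴ) (-s (B₁ᴴ *ᵥ x)) = 0 := by
    rw [qform, hform, h0, dotProduct_zero, Complex.zero_re]
  rwa [qform_fromBlocks_diagonal_of_mem_ker (he x hx) X, hel, her, h1, sub_zero]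

/-- Restrict to the pairs with `S y = 0`, where `S = A₂ - B₂ X B₂ᴴ`: this costs at most rank `S`,
and the form there is that of `A₁ - B₁ X B₁ᴴ` at x. -/
theorem posDim_neg_ker_le :
    posDim (qform (-fromBlocks A₁ 0 0 (-A₂))) (LinearMap.ker (fromRows B₁ B₂)ᴴ.mulVecLin) ≤
      posDim (qform (-(A₁ - B₁ * X * B₁ᴴ)))
        ((LinearMap.range B₂ᴴ.mulVecLin).comap B₁ᴴ.mulVecLin) + (A₂ - B₂ * X * B₂ᴴ).rank := by
  set S := A₂ - B₂ * X * B₂ᴴ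
  set H := LinearMap.ker (fromRows B₁ B₂)ᴴ.mulVecLin
  let g : (ι ⊕ κ → ℂ) →ₗ[ℂ] (κ → ℂ) := S.mulVecLin ∘ₗ LinearMap.funLeft ℂ ℂ Sum.inr
  have h1 := finrank_map_add_finrank_inf_ker g H
  have h2 : finrank ℂ (H.map g) ≤ S.rank := by
    refine Submodule.finrank_mono ?_
    rintro _ ⟨z, -, rfl⟩
    exact ⟨z ∘ Sum.inr, rfl⟩
  have h3 := posDim_add_finrank_le_of_le (qform (-fromBlocks A₁ 0 0 (-A₂)))
    (inf_le_left : H ⊓ LinearMap.ker g ≤ H)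
  have h4 : posDim (qform (-fromBlocks A₁ 0 0 (-A₂))) (H ⊓ LinearMap.ker g) ≤
      posDim (qform (-(A₁ - B₁ * X * B₁ᴴ)))
        ((LinearMap.range B₂ᴴ.mulVecLin).comap B₁ᴴ.mulVecLin) := by
    refine posDim_le_of_map (qform_zero _) (LinearMap.funLeft ℂ ℂ Sum.inl)
      (fun z hz => comp_inl_mem_of_mem_ker hz.1) fun z hz h => ?_
    have hz0 : S *ᵥ (z ∘ Sum.inr) = 0 := hz.2
    rw [qform_neg, qform_fromBlocks_diagonal_of_mem_ker hz.1 X] at h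
    have h0 : qform S (z ∘ Sum.inr) = 0 := by
      rw [qform, hform, hz0, dotProduct_zero, Complex.zero_re]
    change 0 < qform _ (z ∘ Sum.inl)
    rw [qform_neg]
    linarith
  omega

/-- Lift a negative subspace of `A₁ - B₁ X B₁ᴴ` to pairs (x, y) and add the vectors (0, y) with y in
a positive subspace of ker `B₂ᴴ`. The lifts have x ≠ 0, so the sum is direct, and `S ≽ 0` keeps it
negative. -/
theorem posDim_neg_add_le_posDim_neg_ker (hS : ∀ y, 0 ≤ qform (A₂ - B₂ * X * B₂ᴴ) y) :
    posDim (qform (-(A₁ - B₁ * X * B₁ᴴ)))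
        ((LinearMap.range B₂ᴴ.mulVecLin).comap B₁ᴴ.mulVecLin) +
      posDim (qform A₂) (LinearMap.ker B₂ᴴ.mulVecLin) ≤
      posDim (qform (-fromBlocks A₁ 0 0 (-A₂)))
        (LinearMap.ker (fromRows B₁ B₂)ᴴ.mulVecLin) := by
  rw [← posDim_sub_mul_mul_ker A₂ B₂ X]
  obtain ⟨P, hPV, hP, hPpos⟩ := exists_finrank_eq_posDim (qform (-(A₁ - B₁ * X * B₁ᴴ)))
    ((LinearMap.range B₂ᴴ.mulVecLin).comap B₁ᴴ.mulVecLin)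
  obtain ⟨Q, hQK, hQ, hQpos⟩ := exists_finrank_eq_posDim (qform (A₂ - B₂ * X * B₂ᴴ))
    (LinearMap.ker B₂ᴴ.mulVecLin)
  obtain ⟨s, -, hs⟩ := exists_section_on_map B₂ᴴ.mulVecLin ⊤
  let e : (ι → ℂ) →ₗ[ℂ] (ι ⊕ κ → ℂ) :=
    { toFun := fun x => Sum.elim x (-s (B₁ᴴ *ᵥ x))
      map_add' := fun x y => by
        ext (i | i)
        · simp
        · simp [mulVec_add]; ring
      map_smul' := fun c x => by
        ext (i | i)
        · simp
        · simp [mulVec_smul] }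
  let j : (κ → ℂ) →ₗ[ℂ] (ι ⊕ κ → ℂ) :=
    { toFun := fun y => Sum.elim 0 y
      map_add' := fun x y => by ext (i | i) <;> simp
      map_smul' := fun c x => by ext (i | i) <;> simp }
  have hel : ∀ x, e x ∘ Sum.inl = x := fun _ => rfl
  have her : ∀ x, e x ∘ Sum.inr = -s (B₁ᴴ *ᵥ x) := fun _ => rfl
  have hjl : ∀ y, j y ∘ Sum.inl = 0 := fun _ => rfl
  have hjr : ∀ y, j y ∘ Sum.inr = y := fun _ => rfl
  have he : LinearMap.ker e = ⊥ := LinearMap.ker_eq_bot'.2 fun x hx => by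
    rw [← hel x, hx]; rfl
  have hj : LinearMap.ker j = ⊥ := LinearMap.ker_eq_bot'.2 fun x hx => by
    rw [← hjr x, hx]; rfl
  have h1 := finrank_map_add_finrank_inf_ker e P
  have h2 := finrank_map_add_finrank_inf_ker j Q
  have h3 := Submodule.finrank_sup_add_finrank_inf_eq (P.map e) (Q.map j)
  have h4 : P.map e ⊓ Q.map j = ⊥ := by
    rw [Submodule.eq_bot_iff]
    rintro z ⟨⟨x, -, hx⟩, ⟨y, -, hy⟩⟩
    have : x = 0 := by rw [← hel x, hx, ← hy, hjl]
    rw [← hx, this, map_zero]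
  rw [he, inf_bot_eq, finrank_bot] at h1
  rw [hj, inf_bot_eq, finrank_bot] at h2
  rw [h4, finrank_bot] at h3
  have hH : P.map e ⊔ Q.map j ≤ LinearMap.ker (fromRows B₁ B₂)ᴴ.mulVecLin := by
    refine sup_le ?_ ?_
    · rintro _ ⟨x, hx, rfl⟩
      obtain ⟨y, hy⟩ := hPV hx
      have hsx := hs (B₁ᴴ *ᵥ x) ⟨y, trivial, hy⟩
      rw [mulVecLin_apply] at hsx
      rw [mem_ker_conjTranspose_fromRows, hel, her, mulVec_neg, hsx, add_neg_cancel]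
    · rintro _ ⟨y, hy, rfl⟩
      rw [mem_ker_conjTranspose_fromRows, hjl, hjr, mulVec_zero, zero_add]
      exact hQK hy
  have h5 := finrank_le_posDim (q := qform (-fromBlocks A₁ 0 0 (-A₂))) hH ?_
  · omega
  · intro z hz hz0
    rw [qform_neg, qform_fromBlocks_diagonal_of_mem_ker (hH hz) X]
    obtain ⟨_, ⟨x, hx, rfl⟩, _, ⟨y, hy, rfl⟩, rfl⟩ := Submodule.mem_sup.1 hz
    have hl : (e x + j y) ∘ Sum.inl = x := by
      change e x ∘ Sum.inl + j y ∘ Sum.inl = x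
      rw [hel, hjl, add_zero]
    rw [hl]
    by_cases hx0 : x = 0
    · have hr : (e x + j y) ∘ Sum.inr = y := by
        rw [hx0, map_zero, zero_add, hjr]
      have hy0 : y ≠ 0 := by
        rintro rfl
        exact hz0 (by rw [hx0, map_zero, map_zero, add_zero])
      rw [hr, hx0, qform_zero, zero_sub, neg_neg]
      exact hQpos y hy hy0
    · have h6 := hPpos x hx hx0
      have h7 := hS ((e x + j y) ∘ Sum.inr)
      rw [qform_neg] at h6
      linarith

/-- On the vectors of `L` with `Bᴴ x ∈ U`, split `A` into a positive part `P` and a nonpositive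
part, and let π project to `P`, killing the latter. `Y` is the form of `A ∘ π` minus that of `A`,
transported along `Bᴴ`: on `U` it is minus the nonpositive part, and adding it on `L` replaces `A`
by a form factoring through `P`. -/
theorem exists_qform_orth_nonneg {A : Matrix ι ι ℂ} (hA : A.IsHermitian) (B : Matrix ι ν ℂ)
    (U : Submodule ℂ (ν → ℂ)) :
    ∃ Y : Matrix ν ν ℂ, Y.IsHermitian ∧ (∀ w ∈ U, 0 ≤ qform Y w) ∧
      (∀ x ∈ orth A (LinearMap.ker Bᴴ.mulVecLin), 0 ≤ qform (A + B * Y * Bᴴ) x) ∧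
      posDim (qform (A + B * Y * Bᴴ)) (orth A (LinearMap.ker Bᴴ.mulVecLin)) ≤
        posDim (qform A) (U.comap Bᴴ.mulVecLin ⊓ orth A (LinearMap.ker Bᴴ.mulVecLin)) := by
  classical
  set K := LinearMap.ker Bᴴ.mulVecLin with hKdef
  set L := orth A K
  obtain ⟨P, hPE, hPdim, hPpos, hNneg, hsup, hbot⟩ :=
    exists_orth_decomposition hA (U.comap Bᴴ.mulVecLin ⊓ L)
  obtain ⟨π, hπ, hπP, hπN⟩ := exists_projection_of_inf_eq_bot hbot
  obtain ⟨s, hsL, hs⟩ := exists_section_on_map Bᴴ.mulVecLin L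
  -- Not all of `U` need lie in `Bᴴ L`; a projection onto `Bᴴ L` preserving `U` ensures that vectors
  -- of `U` still lift to `L` with image in `U`.
  obtain ⟨ρ, hρ, hρL, hρU⟩ := exists_projection_map_le (L.map Bᴴ.mulVecLin) U
  set p := s ∘ₗ ρ
  have hp : ∀ w, p w = s (ρ w) := fun _ => rfl
  have hpU : ∀ w ∈ U, p w ∈ U.comap Bᴴ.mulVecLin ⊓ L := by
    intro w hw
    refine ⟨?_, hsL _⟩
    change Bᴴ.mulVecLin (s (ρ w)) ∈ U
    rw [hs _ (hρ w)]
    exact hρU w hw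
  set G₁ := LinearMap.toMatrix' (π ∘ₗ p)
  set G₂ := LinearMap.toMatrix' p
  have hG₁ : ∀ w, G₁ *ᵥ w = π (p w) := fun w => LinearMap.toMatrix'_mulVec _ w
  have hG₂ : ∀ w, G₂ *ᵥ w = p w := fun w => LinearMap.toMatrix'_mulVec _ w
  set Y := G₁ᴴ * A * G₁ - G₂ᴴ * A * G₂
  have hY : ∀ w, qform Y w = qform A (π (p w)) - qform A (p w) := by
    intro w
    rw [qform_sub, qform_mul_mul, qform_mul_mul, hG₁, hG₂]
  have hL : ∀ x ∈ L, qform (A + B * Y * Bᴴ) x = qform A (π (p (Bᴴ *ᵥ x))) := by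
    intro x hx
    rw [qform_add, qform_mul_mul_conjTranspose, hY]
    have hBp : Bᴴ *ᵥ p (Bᴴ *ᵥ x) = Bᴴ *ᵥ x := by
      have hmem : Bᴴ *ᵥ x ∈ L.map Bᴴ.mulVecLin := ⟨x, hx, rfl⟩
      rw [hp, hρL _ hmem]
      exact hs _ hmem
    set k := p (Bᴴ *ᵥ x) - x with hkdef
    have hkK : k ∈ K := by
      rw [hKdef, LinearMap.mem_ker, mulVecLin_apply, hkdef, mulVec_sub, hBp, sub_self]
    have hkL : k ∈ L := L.sub_mem (hsL _) hx
    have hk0 : qform A k = 0 := by rw [qform, hkL k hkK, Complex.zero_re]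
    have hpk : p (Bᴴ *ᵥ x) = k + x := by rw [hkdef, sub_add_cancel]
    have h1 : qform A (p (Bᴴ *ᵥ x)) = qform A x := by
      rw [hpk, qform_add_of_hform_eq_zero hA (hx k hkK), hk0, zero_add]
    rw [h1]
    ring
  have hPnn : ∀ x, 0 ≤ qform A (π x) := by
    intro x
    by_cases h0 : π x = 0
    · rw [h0, qform_zero]
    · exact (hPpos _ (hπ x) h0).le
  refine ⟨Y, (isHermitian_conjTranspose_mul_mul _ hA).sub (isHermitian_conjTranspose_mul_mul _ hA),
    ?_, ?_, ?_⟩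
  · intro w hw
    rw [hY]
    have hE := hpU w hw
    rw [← hsup] at hE
    obtain ⟨u, hu, v, hv, huv⟩ := Submodule.mem_sup.1 hE
    rw [← huv, map_add, hπP u hu, hπN v hv, add_zero,
      qform_add_of_hform_eq_zero hA (hv.2 u hu)]
    have := hNneg v hv
    linarith
  · intro x hx
    rw [hL x hx]
    exact hPnn _
  · rw [← hPdim]
    refine le_trans ?_ (posDim_le_finrank (qform A) P)
    refine posDim_le_of_map (qform_zero A) (π ∘ₗ p ∘ₗ Bᴴ.mulVecLin) (fun x _ => hπ _) ?_
    intro x hx h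
    rwa [hL x hx] at h

/-- `G = C Cᴴ` with `C` a projection onto ker `B`: its null vectors are orthogonal to ker `B`, hence
in the range of `Bᴴ`. -/
theorem exists_posSemidef_annihilating (B : Matrix κ ν ℂ) :
    ∃ G : Matrix ν ν ℂ, G.IsHermitian ∧ (∀ w, 0 ≤ qform G w) ∧ B * G = 0 ∧
      ∀ w, qform G w = 0 → w ∈ LinearMap.range Bᴴ.mulVecLin := by
  classical
  obtain ⟨π, hπ, hπK, -⟩ := exists_projection_of_inf_eq_bot
    (inf_bot_eq (LinearMap.ker B.mulVecLin))
  set C := LinearMap.toMatrix' π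
  have hC : ∀ w, C *ᵥ w = π w := fun w => LinearMap.toMatrix'_mulVec _ w
  have hG : (C * Cᴴ).PosSemidef := posSemidef_self_mul_conjTranspose C
  have hG' := posSemidef_iff_qform_nonneg.1 hG
  refine ⟨C * Cᴴ, hG'.1, hG'.2, ?_, fun w hw => ?_⟩
  · have : B * C = 0 := by
      refine Matrix.ext_of_mulVec_single fun i => ?_
      rw [← mulVec_mulVec, hC, zero_mulVec]
      exact hπ _
    rw [← Matrix.mul_assoc, this, Matrix.zero_mul]
  · rw [mem_range_mulVecLin_iff, conjTranspose_conjTranspose]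
    intro k hk
    have h0 : star w ⬝ᵥ (C * Cᴴ) *ᵥ w = 0 := by
      have := hform_self hG'.1 w
      rw [hw, Complex.ofReal_zero] at this
      exact this
    rw [← mulVec_mulVec, star_dotProduct_mulVec_conjTranspose, dotProduct_star_self_eq_zero] at h0
    have hk' : C *ᵥ k = k := by rw [hC, hπK k hk]
    have h1 : star w ⬝ᵥ C *ᵥ k = 0 := by
      rw [star_dotProduct_mulVec_conjTranspose, h0, star_zero, zero_dotProduct]
    rw [← hk', star_dotProduct, h1, star_zero]

end Constrained

/-! ### Definiteness, invertibility and vanishing in terms of inertia and rank. -/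

section InertiaCriteria

open Module

variable {ι : Type*} [Fintype ι] [DecidableEq ι] {A : Matrix ι ι ℂ}

theorem posInertia_add_negInertia (hA : A.IsHermitian) :
    posInertia A + negInertia A = A.rank := by
  rw [posInertia_eq_posDim hA, negInertia_eq_posDim hA, posDim_add_posDim_neg_top hA]

theorem posInertia_neg (hA : A.IsHermitian) : posInertia (-A) = negInertia A := by
  rw [posInertia_eq_posDim hA.neg, negInertia_eq_posDim hA]

theorem negInertia_neg (hA : A.IsHermitian) : negInertia (-A) = posInertia A := by
  rw [posInertia_eq_posDim hA, negInertia_eq_posDim hA.neg, neg_neg]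

theorem posSemidef_iff_negInertia_eq_zero (hA : A.IsHermitian) :
    A.PosSemidef ↔ negInertia A = 0 := by
  rw [posSemidef_iff_qform_nonneg, negInertia_eq_posDim hA, and_iff_right hA]
  constructor
  · exact fun h => posDim_eq_zero_of_nonpos fun x _ => by simpa using h x
  · exact fun h x => by simpa using qform_nonpos_of_posDim_eq_zero h x trivial

theorem posDef_iff_posInertia_eq_card (hA : A.IsHermitian) :
    A.PosDef ↔ posInertia A = Fintype.card ι := by
  rw [posDef_iff_qform_pos, posInertia_eq_posDim hA, and_iff_right hA]
  have h0 := posDim_le_finrank (qform A) ⊤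
  rw [finrank_top, Module.finrank_fintype_fun_eq_card] at h0
  constructor
  · intro h
    have h1 := finrank_le_posDim (q := qform A) (le_refl ⊤) fun x _ => h x
    rw [finrank_top, Module.finrank_fintype_fun_eq_card] at h1
    omega
  · intro h x hx
    obtain ⟨P, -, hP, hpos⟩ := exists_finrank_eq_posDim (qform A) ⊤
    have hPtop : P = ⊤ := Submodule.eq_top_of_finrank_eq (by
      rw [hP, h, Module.finrank_fintype_fun_eq_card])
    exact hpos x (hPtop ▸ Submodule.mem_top) hx

theorem isUnit_iff_rank_eq_card : IsUnit A ↔ A.rank = Fintype.card ι := by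
  constructor
  · exact fun h => rank_of_isUnit A h
  · intro h
    have h1 := rank_add_finrank_ker A
    have h2 : LinearMap.ker A.mulVecLin = ⊥ := Submodule.finrank_eq_zero.1 (by omega)
    rw [← mulVec_injective_iff_isUnit]
    exact LinearMap.ker_eq_bot.1 h2

theorem eq_zero_iff_rank_eq_zero : A = 0 ↔ A.rank = 0 := by
  constructor
  · rintro rfl
    exact rank_zero
  · intro h
    have h1 := Submodule.finrank_eq_zero.1 (show finrank ℂ (LinearMap.range A.mulVecLin) = 0 from h)
    refine Matrix.ext_of_mulVec_single fun i => ?_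
    rw [zero_mulVec]
    exact LinearMap.congr_fun (LinearMap.range_eq_bot.1 h1) (Pi.single i 1)

end InertiaCriteria

/-! ### Bounds on rank and inertia, and their attainment. -/

section Extremal

open Module

variable {m₁ m₂ n : ℕ}
  {A₁ : Matrix (Fin m₁) (Fin m₁) ℂ} {B₁ : Matrix (Fin m₁) (Fin n) ℂ}
  {A₂ : Matrix (Fin m₂) (Fin m₂) ℂ} {B₂ : Matrix (Fin m₂) (Fin n) ℂ}
  {X : Matrix (Fin n) (Fin n) ℂ}

theorem isHermitian_blockDiagonal (hA₁ : A₁.IsHermitian) (hA₂ : A₂.IsHermitian) :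
    (fromBlocks A₁ 0 0 (-A₂)).IsHermitian :=
  hA₁.fromBlocks (conjTranspose_zero) hA₂.neg

theorem posInertia_bordered (hA₁ : A₁.IsHermitian) :
    posInertia (bordered A₁ B₁) =
      B₁.rank + posDim (qform A₁) (LinearMap.ker B₁ᴴ.mulVecLin) := by
  rw [bordered, posInertia_eq_posDim (hA₁.fromBlocks rfl isHermitian_zero),
    posDim_fromBlocks hA₁]

theorem blockM_eq : blockM A₁ B₁ A₂ B₂ =
    fromBlocks (fromBlocks A₁ 0 0 (-A₂)) (fromRows B₁ B₂) (fromRows B₁ B₂)ᴴ 0 := by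
  rw [blockM, conjTranspose_fromRows_eq_fromCols_conjTranspose]

theorem posInertia_blockM (hA₁ : A₁.IsHermitian) (hA₂ : A₂.IsHermitian) :
    posInertia (blockM A₁ B₁ A₂ B₂) = (fromRows B₁ B₂).rank +
      posDim (qform (fromBlocks A₁ 0 0 (-A₂)))
        (LinearMap.ker (fromRows B₁ B₂)ᴴ.mulVecLin) := by
  have hD := isHermitian_blockDiagonal hA₁ hA₂
  rw [blockM_eq, posInertia_eq_posDim (hD.fromBlocks rfl isHermitian_zero), posDim_fromBlocks hD]

theorem negInertia_blockM (hA₁ : A₁.IsHermitian) (hA₂ : A₂.IsHermitian) :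
    negInertia (blockM A₁ B₁ A₂ B₂) = (fromRows B₁ B₂).rank +
      posDim (qform (-fromBlocks A₁ 0 0 (-A₂)))
        (LinearMap.ker (fromRows B₁ B₂)ᴴ.mulVecLin) := by
  have hD := isHermitian_blockDiagonal hA₁ hA₂
  rw [blockM_eq, negInertia_eq_posDim (hD.fromBlocks rfl isHermitian_zero),
    posDim_neg_fromBlocks hD]

theorem rank_fromCols_add_orth (A₁ : Matrix (Fin m₁) (Fin m₁) ℂ)
    (B₁ : Matrix (Fin m₁) (Fin n) ℂ) :
    (fromCols A₁ B₁).rank + finrank ℂ (orth A₁ (LinearMap.ker B₁ᴴ.mulVecLin)) =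
      m₁ + B₁.rank := by
  have := rank_fromCols_add A₁ B₁
  rwa [comap_range_eq_orth, Fintype.card_fin] at this

theorem rank_fromRows_add_comap (B₁ : Matrix (Fin m₁) (Fin n) ℂ)
    (B₂ : Matrix (Fin m₂) (Fin n) ℂ) :
    (fromRows B₁ B₂).rank +
      finrank ℂ ((LinearMap.range B₂ᴴ.mulVecLin).comap B₁ᴴ.mulVecLin) = m₁ + B₂.rank := by
  have := rank_fromCols_add B₁ᴴ B₂ᴴ
  rwa [← conjTranspose_fromRows_eq_fromCols_conjTranspose, rank_conjTranspose,
    rank_conjTranspose, Fintype.card_fin] at this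

theorem rank_blockN_add (A₁ : Matrix (Fin m₁) (Fin m₁) ℂ) (B₁ : Matrix (Fin m₁) (Fin n) ℂ)
    (B₂ : Matrix (Fin m₂) (Fin n) ℂ) :
    (blockN A₁ B₁ B₂).rank +
      finrank ℂ ((LinearMap.range B₂ᴴ.mulVecLin).comap B₁ᴴ.mulVecLin ⊓
        orth A₁ (LinearMap.ker B₁ᴴ.mulVecLin) : Submodule ℂ (Fin m₁ → ℂ)) =
      m₁ + (B₁.rank + B₂.rank) := by
  have h := rank_fromCols_add (fromRows A₁ B₁ᴴ) (fromBlocks B₁ 0 0 B₂ᴴ)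
  have h1 : blockN A₁ B₁ B₂ = fromCols (fromRows A₁ B₁ᴴ) (fromBlocks B₁ 0 0 B₂ᴴ) := by
    rw [blockN, ← fromCols_fromRows_eq_fromBlocks, fromRows_fromCols_eq_fromBlocks]
  have h2 : (LinearMap.range (fromBlocks B₁ 0 0 B₂ᴴ).mulVecLin).comap
      (fromRows A₁ B₁ᴴ).mulVecLin =
      (LinearMap.range B₂ᴴ.mulVecLin).comap B₁ᴴ.mulVecLin ⊓
        orth A₁ (LinearMap.ker B₁ᴴ.mulVecLin) := by
    rw [← comap_range_eq_orth]
    ext x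
    simp only [Submodule.mem_comap, Submodule.mem_inf, mulVecLin_apply, fromRows_mulVec,
      LinearMap.mem_range, fromBlocks_mulVec, zero_mulVec, add_zero, zero_add, Sum.elim_eq_iff]
    constructor
    · rintro ⟨y, h, h'⟩
      exact ⟨⟨_, h'⟩, ⟨_, h⟩⟩
    · rintro ⟨⟨y, h⟩, ⟨z, h'⟩⟩
      exact ⟨Sum.elim z y, h', h⟩
  rwa [← h1, h2, rank_fromBlocks_diagonal, rank_conjTranspose, Fintype.card_fin] at h

theorem ker_le_comap_range (B₁ : Matrix (Fin m₁) (Fin n) ℂ) (B₂ : Matrix (Fin m₂) (Fin n) ℂ) :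
    LinearMap.ker B₁ᴴ.mulVecLin ≤ (LinearMap.range B₂ᴴ.mulVecLin).comap B₁ᴴ.mulVecLin :=
  LinearMap.ker_le_comap _

theorem rank_add_finrank_ker_conjTranspose (B₁ : Matrix (Fin m₁) (Fin n) ℂ) :
    B₁.rank + finrank ℂ (LinearMap.ker B₁ᴴ.mulVecLin) = m₁ := by
  have := rank_add_finrank_ker B₁ᴴ
  rwa [rank_conjTranspose, Fintype.card_fin] at this

theorem lmiSolutions_nonempty_iff (hA₂ : A₂.IsHermitian) :
    (lmiSolutions A₂ B₂).Nonempty ↔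
      posInertia (bordered A₂ B₂) = (fromCols A₂ B₂).rank := by
  have h1 := rank_fromCols_add_orth A₂ B₂
  have h2 := posInertia_bordered (B₁ := B₂) hA₂
  constructor
  · rintro ⟨X, hX, hS⟩
    have h3 := posDim_ker_add_finrank_orth_of_posSemidef hA₂ hX hS
    rw [Fintype.card_fin] at h3
    omega
  · intro h
    obtain ⟨X, hX, hS, -⟩ := exists_posSemidef_sub_mul_mul (B := B₂) hA₂ (by
      rw [Fintype.card_fin]; omega)
    exact ⟨X, hX, hS⟩

theorem posDim_ker_add_orth_of_mem (hA₂ : A₂.IsHermitian) (hX : X ∈ lmiSolutions A₂ B₂) :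
    posDim (qform A₂) (LinearMap.ker B₂ᴴ.mulVecLin) +
      finrank ℂ (orth A₂ (LinearMap.ker B₂ᴴ.mulVecLin)) = m₂ := by
  have := posDim_ker_add_finrank_orth_of_posSemidef hA₂ hX.1 hX.2
  rwa [Fintype.card_fin] at this

theorem qform_nonneg_of_mem (hX : X ∈ lmiSolutions A₂ B₂) (y : Fin m₂ → ℂ) :
    0 ≤ qform (A₂ - B₂ * X * B₂ᴴ) y :=
  (posSemidef_iff_qform_nonneg.1 hX.2).2 y

theorem rank_sub_mul_mul_le (A₁ : Matrix (Fin m₁) (Fin m₁) ℂ) (B₁ : Matrix (Fin m₁) (Fin n) ℂ)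
    (X : Matrix (Fin n) (Fin n) ℂ) :
    (A₁ - B₁ * X * B₁ᴴ).rank ≤ (fromCols A₁ B₁).rank := by
  have h : A₁ - B₁ * X * B₁ᴴ = fromCols A₁ B₁ *
      fromRows (1 : Matrix (Fin m₁) (Fin m₁) ℂ) (-(X * B₁ᴴ)) := by
    rw [fromCols_mul_fromRows, Matrix.mul_one, Matrix.mul_neg, Matrix.mul_assoc, sub_eq_add_neg]
  rw [h]
  exact rank_mul_le_left _ _

theorem posInertia_le (hA₁ : A₁.IsHermitian) (hX : X.IsHermitian) :
    posInertia (A₁ - B₁ * X * B₁ᴴ) ≤ posInertia (bordered A₁ B₁) := by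
  have hφ := isHermitian_sub_mul_mul hA₁ B₁ hX
  rw [posInertia_eq_posDim hφ, posInertia_bordered hA₁, ← posDim_sub_mul_mul_ker A₁ B₁ X]
  have h1 := posDim_add_finrank_le_of_le (qform (A₁ - B₁ * X * B₁ᴴ))
    (le_top : LinearMap.ker B₁ᴴ.mulVecLin ≤ ⊤)
  have h2 := rank_add_finrank_ker_conjTranspose B₁
  rw [finrank_top, Module.finrank_fin_fun] at h1
  omega

/-- In the orthogonal formula for ker `B₁ᴴ`, `X` survives only in the indices on the whole space and
on the orthogonal. -/
theorem posDim_top_orth_formula (hA₁ : A₁.IsHermitian) (hX : X.IsHermitian) :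
    posDim (qform (A₁ - B₁ * X * B₁ᴴ)) ⊤ + finrank ℂ (LinearMap.ker B₁ᴴ.mulVecLin) +
        finrank ℂ (orth A₁ (LinearMap.ker B₁ᴴ.mulVecLin)) =
      posDim (qform A₁) (LinearMap.ker B₁ᴴ.mulVecLin) +
        posDim (qform (A₁ - B₁ * X * B₁ᴴ)) (orth A₁ (LinearMap.ker B₁ᴴ.mulVecLin)) + m₁ +
        finrank ℂ (LinearMap.ker B₁ᴴ.mulVecLin ⊓ orth A₁ (LinearMap.ker B₁ᴴ.mulVecLin) :
          Submodule ℂ (Fin m₁ → ℂ)) := by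
  have h := posDim_orth_formula (isHermitian_sub_mul_mul hA₁ B₁ hX)
    (le_top : LinearMap.ker B₁ᴴ.mulVecLin ≤ ⊤)
  rwa [top_inf_eq, orth_sub_mul_mul, posDim_sub_mul_mul_ker, finrank_top,
    Module.finrank_fin_fun] at h

theorem posDim_neg_top_orth_formula (hA₁ : A₁.IsHermitian) (hX : X.IsHermitian) :
    posDim (qform (-(A₁ - B₁ * X * B₁ᴴ))) ⊤ + finrank ℂ (LinearMap.ker B₁ᴴ.mulVecLin) +
        finrank ℂ (orth A₁ (LinearMap.ker B₁ᴴ.mulVecLin)) =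
      posDim (qform (-A₁)) (LinearMap.ker B₁ᴴ.mulVecLin) +
        posDim (qform (-(A₁ - B₁ * X * B₁ᴴ))) (orth A₁ (LinearMap.ker B₁ᴴ.mulVecLin)) + m₁ +
        finrank ℂ (LinearMap.ker B₁ᴴ.mulVecLin ⊓ orth A₁ (LinearMap.ker B₁ᴴ.mulVecLin) :
          Submodule ℂ (Fin m₁ → ℂ)) := by
  have h := posDim_orth_formula (isHermitian_sub_mul_mul hA₁ B₁ hX).neg
    (le_top : LinearMap.ker B₁ᴴ.mulVecLin ≤ ⊤)
  rwa [top_inf_eq, orth_neg, orth_sub_mul_mul, posDim_neg_sub_mul_mul_ker, finrank_top,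
    Module.finrank_fin_fun] at h

theorem posDim_comap_orth_formula (hA₁ : A₁.IsHermitian) (hX : X.IsHermitian)
    (B₂ : Matrix (Fin m₂) (Fin n) ℂ) :
    posDim (qform (A₁ - B₁ * X * B₁ᴴ))
          ((LinearMap.range B₂ᴴ.mulVecLin).comap B₁ᴴ.mulVecLin) +
        finrank ℂ (LinearMap.ker B₁ᴴ.mulVecLin) +
        finrank ℂ ((LinearMap.range B₂ᴴ.mulVecLin).comap B₁ᴴ.mulVecLin ⊓
          orth A₁ (LinearMap.ker B₁ᴴ.mulVecLin) : Submodule ℂ (Fin m₁ → ℂ)) =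
      posDim (qform A₁) (LinearMap.ker B₁ᴴ.mulVecLin) +
        posDim (qform (A₁ - B₁ * X * B₁ᴴ))
          ((LinearMap.range B₂ᴴ.mulVecLin).comap B₁ᴴ.mulVecLin ⊓
            orth A₁ (LinearMap.ker B₁ᴴ.mulVecLin)) +
        finrank ℂ ((LinearMap.range B₂ᴴ.mulVecLin).comap B₁ᴴ.mulVecLin) +
        finrank ℂ (LinearMap.ker B₁ᴴ.mulVecLin ⊓ orth A₁ (LinearMap.ker B₁ᴴ.mulVecLin) :
          Submodule ℂ (Fin m₁ → ℂ)) := by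
  have h := posDim_orth_formula (isHermitian_sub_mul_mul hA₁ B₁ hX) (ker_le_comap_range B₁ B₂)
  rwa [orth_sub_mul_mul, posDim_sub_mul_mul_ker] at h

/-- The orthogonal formulas on the whole space and on V differ in the index on L against that on V ∩
L, where monotonicity applies; the index on V is at least the one coming from M. -/
theorem le_posInertia (hA₁ : A₁.IsHermitian) (hA₂ : A₂.IsHermitian)
    (hX : X ∈ lmiSolutions A₂ B₂) :
    (fromCols A₁ B₁).rank + posInertia (blockM A₁ B₁ A₂ B₂) ≤
      posInertia (A₁ - B₁ * X * B₁ᴴ) + (blockN A₁ B₁ B₂).rank := by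
  rw [posInertia_eq_posDim (isHermitian_sub_mul_mul hA₁ B₁ hX.1), posInertia_blockM hA₁ hA₂]
  have h1 := rank_fromCols_add_orth A₁ B₁
  have h2 := rank_blockN_add A₁ B₁ B₂
  have h3 := rank_fromRows_add_comap B₁ B₂
  have h4 := posDim_top_orth_formula (B₁ := B₁) hA₁ hX.1
  have h5 := posDim_comap_orth_formula (B₁ := B₁) hA₁ hX.1 B₂
  have h6 := posDim_ker_le_of_posSemidef (A₁ := A₁) (B₁ := B₁) (qform_nonneg_of_mem hX)
  have h7 : posDim (qform (A₁ - B₁ * X * B₁ᴴ))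
      ((LinearMap.range B₂ᴴ.mulVecLin).comap B₁ᴴ.mulVecLin ⊓
        orth A₁ (LinearMap.ker B₁ᴴ.mulVecLin)) ≤
      posDim (qform (A₁ - B₁ * X * B₁ᴴ)) (orth A₁ (LinearMap.ker B₁ᴴ.mulVecLin)) :=
    posDim_mono inf_le_right
  omega

theorem negInertia_le (hA₁ : A₁.IsHermitian) (hA₂ : A₂.IsHermitian)
    (hX : X ∈ lmiSolutions A₂ B₂) :
    negInertia (A₁ - B₁ * X * B₁ᴴ) + (fromCols A₂ B₂).rank ≤
      negInertia (blockM A₁ B₁ A₂ B₂) := by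
  rw [negInertia_eq_posDim (isHermitian_sub_mul_mul hA₁ B₁ hX.1), negInertia_blockM hA₁ hA₂]
  have h1 := rank_fromCols_add_orth A₂ B₂
  have h2 := posDim_ker_add_orth_of_mem hA₂ hX
  have h3 := rank_fromRows_add_comap B₁ B₂
  have h4 := posDim_neg_add_le_posDim_neg_ker (A₁ := A₁) (B₁ := B₁) (qform_nonneg_of_mem hX)
  have h5 := posDim_add_finrank_le_of_le (qform (-(A₁ - B₁ * X * B₁ᴴ)))
    (le_top : (LinearMap.range B₂ᴴ.mulVecLin).comap B₁ᴴ.mulVecLin ≤ ⊤)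
  rw [finrank_top, Module.finrank_fin_fun] at h5
  omega

theorem le_negInertia (hA₁ : A₁.IsHermitian) (hX : X.IsHermitian) :
    (fromCols A₁ B₁).rank ≤
      negInertia (A₁ - B₁ * X * B₁ᴴ) + posInertia (bordered A₁ B₁) := by
  rw [negInertia_eq_posDim (isHermitian_sub_mul_mul hA₁ B₁ hX), posInertia_bordered hA₁]
  have h1 := rank_fromCols_add_orth A₁ B₁
  have h2 := posDim_neg_top_orth_formula (B₁ := B₁) hA₁ hX
  have h3 := posDim_add_posDim_neg_add hA₁ (LinearMap.ker B₁ᴴ.mulVecLin)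
  omega

theorem exists_posInertia_eq_max (hA₁ : A₁.IsHermitian) (hT : (lmiSolutions A₂ B₂).Nonempty) :
    ∃ X ∈ lmiSolutions A₂ B₂,
      posInertia (A₁ - B₁ * X * B₁ᴴ) = posInertia (bordered A₁ B₁) ∧
      (A₁ - B₁ * X * B₁ᴴ).rank = (fromCols A₁ B₁).rank := by
  obtain ⟨X, hX⟩ := hT
  have hG : (B₁ * B₁ᴴ).PosSemidef := posSemidef_self_mul_conjTranspose B₁
  have hG0 := posSemidef_iff_qform_nonneg.1 hG
  obtain ⟨t, ht, h⟩ := exists_posDim_add_smul (W := LinearMap.ker B₁ᴴ.mulVecLin)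
    (A₁ - B₁ * X * B₁ᴴ) hG0.2 fun x hx => by
      have h0 := mulVec_eq_zero_of_qform_eq_zero hG0.1 hG0.2 hx
      have h1 : star x ⬝ᵥ B₁ *ᵥ (B₁ᴴ *ᵥ x) = 0 := by
        rw [mulVec_mulVec, h0, dotProduct_zero]
      rw [star_dotProduct_mulVec_conjTranspose] at h1
      exact dotProduct_star_self_eq_zero.1 h1
  have htH : ((t : ℂ) • (1 : Matrix (Fin n) (Fin n) ℂ)).PosSemidef :=
    PosSemidef.one.smul (Complex.zero_le_real.2 ht)
  have hY : X - (t : ℂ) • 1 ∈ lmiSolutions A₂ B₂ := by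
    refine ⟨hX.1.sub htH.1, ?_⟩
    have : A₂ - B₂ * (X - (t : ℂ) • 1) * B₂ᴴ =
        (A₂ - B₂ * X * B₂ᴴ) + B₂ * ((t : ℂ) • (1 : Matrix (Fin n) (Fin n) ℂ)) * B₂ᴴ := by
      rw [Matrix.mul_sub, Matrix.sub_mul]; abel
    rw [this]
    exact hX.2.add (htH.mul_mul_conjTranspose_same B₂)
  have hφ : A₁ - B₁ * (X - (t : ℂ) • 1) * B₁ᴴ =
      (A₁ - B₁ * X * B₁ᴴ) + (t : ℂ) • (B₁ * B₁ᴴ) := by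
    rw [Matrix.mul_sub, Matrix.sub_mul, Matrix.mul_smul, Matrix.mul_one, Matrix.smul_mul]; abel
  rw [← hφ, posDim_sub_mul_mul_ker, Fintype.card_fin,
    ← posInertia_eq_posDim (isHermitian_sub_mul_mul hA₁ B₁ hY.1)] at h
  have h1 := posInertia_bordered (B₁ := B₁) hA₁
  have h2 := rank_add_finrank_ker_conjTranspose B₁
  have h3 := posInertia_le (B₁ := B₁) hA₁ hY.1
  have h4 := le_negInertia (B₁ := B₁) hA₁ hY.1
  have h5 := posInertia_add_negInertia (isHermitian_sub_mul_mul hA₁ B₁ hY.1)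
  have h6 := rank_sub_mul_mul_le A₁ B₁ (X - (t : ℂ) • 1)
  -- With i₊ at its maximum, the lower bound for i₋ pushes the rank up to its upper bound.
  exact ⟨_, hY, by omega, by omega⟩

theorem exists_isMinimal_mem_lmiSolutions (hA₂ : A₂.IsHermitian)
    (hT : (lmiSolutions A₂ B₂).Nonempty) :
    ∃ X ∈ lmiSolutions A₂ B₂,
      (A₂ - B₂ * X * B₂ᴴ).rank ≤ posDim (qform A₂) (LinearMap.ker B₂ᴴ.mulVecLin) ∧
      LinearMap.ker B₂ᴴ.mulVecLin ⊔ LinearMap.ker (A₂ - B₂ * X * B₂ᴴ).mulVecLin = ⊤ := by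
  obtain ⟨X, hX⟩ := hT
  obtain ⟨Y, hY, hYS, h⟩ := exists_posSemidef_sub_mul_mul (B := B₂) hA₂ (by
      rw [posDim_ker_add_orth_of_mem hA₂ hX, Fintype.card_fin])
  exact ⟨Y, ⟨hY, hYS⟩, h⟩

theorem exists_negInertia_eq_max (hA₁ : A₁.IsHermitian) (hA₂ : A₂.IsHermitian)
    (hT : (lmiSolutions A₂ B₂).Nonempty) :
    ∃ X ∈ lmiSolutions A₂ B₂, negInertia (A₁ - B₁ * X * B₁ᴴ) + (fromCols A₂ B₂).rank =
      negInertia (blockM A₁ B₁ A₂ B₂) := by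
  -- Minimal rank of `A₂ - B₂ X B₂ᴴ` makes the loss in `posDim_neg_ker_le` as small as possible;
  -- moving along `G` leaves that matrix unchanged.
  obtain ⟨X, hX, hrank, -⟩ := exists_isMinimal_mem_lmiSolutions hA₂ hT
  obtain ⟨G, hG, hG0, hBG, hGr⟩ := exists_posSemidef_annihilating B₂
  obtain ⟨t, ht, h⟩ := exists_posDim_add_smul (G := B₁ * G * B₁ᴴ)
    (W := (LinearMap.range B₂ᴴ.mulVecLin).comap B₁ᴴ.mulVecLin) (-(A₁ - B₁ * X * B₁ᴴ))
    (fun x => by rw [qform_mul_mul_conjTranspose]; exact hG0 _)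
    fun x hx => by
      rw [qform_mul_mul_conjTranspose] at hx
      exact hGr _ hx
  have htG : ((t : ℂ) • G).IsHermitian := by
    rw [Matrix.IsHermitian, conjTranspose_smul, hG.eq, Complex.star_def, Complex.conj_ofReal]
  have hY : X + (t : ℂ) • G ∈ lmiSolutions A₂ B₂ := by
    refine ⟨hX.1.add htG, ?_⟩
    rw [Matrix.mul_add, Matrix.mul_smul, hBG, smul_zero, add_zero]
    exact hX.2
  have hφ : -(A₁ - B₁ * (X + (t : ℂ) • G) * B₁ᴴ) =
      -(A₁ - B₁ * X * B₁ᴴ) + (t : ℂ) • (B₁ * G * B₁ᴴ) := by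
    rw [Matrix.mul_add, Matrix.add_mul, Matrix.mul_smul, Matrix.smul_mul]; abel
  rw [← hφ, Fintype.card_fin,
    ← negInertia_eq_posDim (isHermitian_sub_mul_mul hA₁ B₁ hY.1)] at h
  have h1 := rank_fromCols_add_orth A₂ B₂
  have h2 := posDim_ker_add_orth_of_mem hA₂ hX
  have h3 := rank_fromRows_add_comap B₁ B₂
  have h4 := posDim_neg_ker_le (A₁ := A₁) (B₁ := B₁) (A₂ := A₂) (B₂ := B₂) (X := X)
  have h5 := negInertia_le (B₁ := B₁) hA₁ hA₂ hY
  have h6 := negInertia_blockM (B₁ := B₁) (B₂ := B₂) hA₁ hA₂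
  exact ⟨_, hY, by omega⟩

theorem exists_inertia_eq_min (hA₁ : A₁.IsHermitian) (hA₂ : A₂.IsHermitian)
    (hT : (lmiSolutions A₂ B₂).Nonempty) :
    ∃ X ∈ lmiSolutions A₂ B₂,
      posInertia (A₁ - B₁ * X * B₁ᴴ) + (blockN A₁ B₁ B₂).rank =
        (fromCols A₁ B₁).rank + posInertia (blockM A₁ B₁ A₂ B₂) ∧
      negInertia (A₁ - B₁ * X * B₁ᴴ) + posInertia (bordered A₁ B₁) =
        (fromCols A₁ B₁).rank := by
  obtain ⟨X, hX, -, hsup⟩ := exists_isMinimal_mem_lmiSolutions hA₂ hT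
  obtain ⟨Y, hY, hYU, hnn, hle⟩ := exists_qform_orth_nonneg
    (isHermitian_sub_mul_mul hA₁ B₁ hX.1) B₁ (LinearMap.range B₂ᴴ.mulVecLin)
  have hZ : X - Y ∈ lmiSolutions A₂ B₂ := by
    refine ⟨hX.1.sub hY, posSemidef_iff_qform_nonneg.2
      ⟨isHermitian_sub_mul_mul hA₂ B₂ (hX.1.sub hY), fun x => ?_⟩⟩
    have : A₂ - B₂ * (X - Y) * B₂ᴴ = (A₂ - B₂ * X * B₂ᴴ) + B₂ * Y * B₂ᴴ := by
      rw [Matrix.mul_sub, Matrix.sub_mul]; abel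
    rw [this, qform_add, qform_mul_mul_conjTranspose]
    exact add_nonneg (qform_nonneg_of_mem hX x) (hYU _ ⟨x, rfl⟩)
  have hφ : A₁ - B₁ * X * B₁ᴴ + B₁ * Y * B₁ᴴ = A₁ - B₁ * (X - Y) * B₁ᴴ := by
    rw [Matrix.mul_sub, Matrix.sub_mul]; abel
  rw [hφ, orth_sub_mul_mul] at hnn hle
  have hφH := isHermitian_sub_mul_mul hA₁ B₁ hZ.1
  have h0 : posDim (qform (-(A₁ - B₁ * (X - Y) * B₁ᴴ)))
      (orth A₁ (LinearMap.ker B₁ᴴ.mulVecLin)) = 0 :=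
    posDim_eq_zero_of_nonpos fun x hx => by
      rw [qform_neg, Left.neg_nonpos_iff]
      exact hnn x hx
  have h1 := rank_fromCols_add_orth A₁ B₁
  have h2 := rank_blockN_add A₁ B₁ B₂
  have h3 := rank_fromRows_add_comap B₁ B₂
  have h4 := posDim_top_orth_formula (B₁ := B₁) hA₁ hZ.1
  have h5 := posDim_neg_top_orth_formula (B₁ := B₁) hA₁ hZ.1
  have h6 := posDim_comap_orth_formula (B₁ := B₁) hA₁ hX.1 B₂
  have h7 := posDim_le_posDim_ker (A₁ := A₁) (B₁ := B₁) hsup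
  have h8 := le_posInertia (B₁ := B₁) hA₁ hA₂ hZ
  have h9 := posInertia_blockM (B₁ := B₁) (B₂ := B₂) hA₁ hA₂
  have h10 := posInertia_bordered (B₁ := B₁) hA₁
  have h11 := posDim_add_posDim_neg_add hA₁ (LinearMap.ker B₁ᴴ.mulVecLin)
  rw [← posInertia_eq_posDim hφH] at h4
  rw [← negInertia_eq_posDim hφH] at h5
  exact ⟨_, hZ, by omega, by omega⟩

/-- The inclusion makes the orthogonal of ker `B₁ᴴ` the whole space, so `A₁` vanishes on ker `B₁ᴴ`.
-/
theorem ranks_of_colSpace_le (hA₁ : A₁.IsHermitian) (B₂ : Matrix (Fin m₂) (Fin n) ℂ)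
    (h : colSpace A₁ ≤ colSpace B₁) :
    (fromCols A₁ B₁).rank = posInertia (bordered A₁ B₁) ∧
      (blockN A₁ B₁ B₂).rank = (fromCols A₁ B₁).rank + (fromRows B₁ B₂).rank := by
  have htop : orth A₁ (LinearMap.ker B₁ᴴ.mulVecLin) = ⊤ := by
    rw [← comap_range_eq_orth, eq_top_iff]
    exact fun x _ => h ⟨x, rfl⟩
  have h1 := rank_fromCols_add_orth A₁ B₁
  have h2 := rank_blockN_add A₁ B₁ B₂
  have h3 := rank_fromRows_add_comap B₁ B₂
  have h4 := posInertia_bordered (B₁ := B₁) hA₁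
  have h5 := posDim_add_posDim_neg_add hA₁ (LinearMap.ker B₁ᴴ.mulVecLin)
  rw [htop, inf_top_eq] at h2 h5
  rw [htop, finrank_top, Module.finrank_fin_fun] at h1
  omega

end Extremal

/-! ### The extremal values and their consequences. -/

theorem theorem3p4 {m₁ m₂ n : ℕ}
    (A₁ : Matrix (Fin m₁) (Fin m₁) ℂ) (B₁ : Matrix (Fin m₁) (Fin n) ℂ)
    (A₂ : Matrix (Fin m₂) (Fin m₂) ℂ) (B₂ : Matrix (Fin m₂) (Fin n) ℂ)
    (hA₁ : A₁.IsHermitian) (hA₂ : A₂.IsHermitian) :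
    let M := blockM A₁ B₁ A₂ B₂
    let N := blockN A₁ B₁ B₂
    let M₁ := bordered A₁ B₁
    let T := lmiSolutions A₂ B₂
    let φ : Matrix (Fin n) (Fin n) ℂ → Matrix (Fin m₁) (Fin m₁) ℂ := fun X => A₁ - B₁ * X * B₁ᴴ
    -- the criterion for consistency of the constraint
    (T.Nonempty ↔ posInertia (bordered A₂ B₂) = (fromCols A₂ B₂).rank) ∧
    (T.Nonempty →
      -- the six extremal values (attained)
      IsGreatest ((fun X => ((φ X).rank : ℤ)) '' T) (fromCols A₁ B₁).rank ∧
      IsLeast ((fun X => ((φ X).rank : ℤ)) '' T)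
        (2 * (fromCols A₁ B₁).rank + posInertia M - posInertia M₁ - N.rank) ∧
      IsGreatest ((fun X => (posInertia (φ X) : ℤ)) '' T) (posInertia M₁) ∧
      IsLeast ((fun X => (posInertia (φ X) : ℤ)) '' T)
        ((fromCols A₁ B₁).rank - N.rank + posInertia M) ∧
      IsGreatest ((fun X => (negInertia (φ X) : ℤ)) '' T)
        (negInertia M - (fromCols A₂ B₂).rank) ∧
      IsLeast ((fun X => (negInertia (φ X) : ℤ)) '' T)
        ((fromCols A₁ B₁).rank - posInertia M₁) ∧
      -- (a)
      ((∃ X ∈ T, IsUnit (φ X)) ↔ (fromCols A₁ B₁).rank = m₁) ∧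
      -- (b)
      ((∀ X ∈ T, IsUnit (φ X)) ↔
        (fromCols A₁ B₁).rank = m₁ ∧
          (posInertia M : ℤ) = posInertia M₁ + N.rank - m₁) ∧
      -- (c)
      ((∃ X ∈ T, B₁ * X * B₁ᴴ = A₁) ↔
        colSpace A₁ ≤ colSpace B₁ ∧ posInertia M = (fromRows B₁ B₂).rank) ∧
      -- (d)
      ((∃ X ∈ T, (A₁ - B₁ * X * B₁ᴴ).PosDef) ↔ posInertia M₁ = m₁) ∧
      -- (e)
      ((∃ X ∈ T, (B₁ * X * B₁ᴴ - A₁).PosDef) ↔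
        negInertia M = (fromCols A₂ B₂).rank + m₁) ∧
      -- (f)
      ((∃ X ∈ T, (A₁ - B₁ * X * B₁ᴴ).PosSemidef) ↔
        posInertia M₁ = (fromCols A₁ B₁).rank) ∧
      -- (g)
      ((∃ X ∈ T, (B₁ * X * B₁ᴴ - A₁).PosSemidef) ↔
        (posInertia M : ℤ) = N.rank - (fromCols A₁ B₁).rank) ∧
      -- (h)
      ((∀ X ∈ T, (A₁ - B₁ * X * B₁ᴴ).PosSemidef) ↔
        negInertia M = (fromCols A₂ B₂).rank) ∧
      (T ⊆ lmiSolutions A₁ B₁ ↔ negInertia M = (fromCols A₂ B₂).rank) ∧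
      -- (i)
      ((∀ X ∈ T, ∀ Y ∈ T, (φ X).rank = (φ Y).rank) ↔
        (posInertia M : ℤ) = posInertia M₁ + N.rank - (fromCols A₁ B₁).rank) ∧
      -- (j)
      ((∀ X ∈ T, ∀ Y ∈ T, posInertia (φ X) = posInertia (φ Y)) ↔
        posInertia M₁ + N.rank = (fromCols A₁ B₁).rank + posInertia M) ∧
      -- (k)
      ((∀ X ∈ T, ∀ Y ∈ T, negInertia (φ X) = negInertia (φ Y)) ↔
        negInertia M + posInertia M₁ = (fromCols A₁ B₁).rank + (fromCols A₂ B₂).rank)) := by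
  intro M N M₁ T φ
  refine ⟨lmiSolutions_nonempty_iff hA₂, fun hT => ?_⟩
  have hφ : ∀ X ∈ T, (φ X).IsHermitian := fun X hX => isHermitian_sub_mul_mul hA₁ B₁ hX.1
  have hneg : ∀ X, B₁ * X * B₁ᴴ - A₁ = -φ X := fun X => (neg_sub _ _).symm
  have hsum : ∀ X ∈ T, posInertia (φ X) + negInertia (φ X) = (φ X).rank :=
    fun X hX => posInertia_add_negInertia (hφ X hX)
  have hrank : ∀ X, (φ X).rank ≤ (fromCols A₁ B₁).rank := rank_sub_mul_mul_le A₁ B₁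
  have hpmax : ∀ X ∈ T, posInertia (φ X) ≤ posInertia M₁ := fun X hX => posInertia_le hA₁ hX.1
  have hpmin : ∀ X ∈ T, (fromCols A₁ B₁).rank + posInertia M ≤ posInertia (φ X) + N.rank :=
    fun X hX => le_posInertia hA₁ hA₂ hX
  have hnmax : ∀ X ∈ T, negInertia (φ X) + (fromCols A₂ B₂).rank ≤ negInertia M :=
    fun X hX => negInertia_le hA₁ hA₂ hX
  have hnmin : ∀ X ∈ T, (fromCols A₁ B₁).rank ≤ negInertia (φ X) + posInertia M₁ :=
    fun X hX => le_negInertia hA₁ hX.1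
  -- Three points realize all six extrema: `Xa` the maxima of rank and i₊, `Xb` all three minima,
  -- `Xc` the maximum of i₋.
  obtain ⟨Xa, hXa, hXap, hXar⟩ : ∃ X ∈ T, posInertia (φ X) = posInertia M₁ ∧
      (φ X).rank = (fromCols A₁ B₁).rank := exists_posInertia_eq_max hA₁ hT
  obtain ⟨Xb, hXb, hXbp, hXbn⟩ : ∃ X ∈ T,
      posInertia (φ X) + N.rank = (fromCols A₁ B₁).rank + posInertia M ∧
      negInertia (φ X) + posInertia M₁ = (fromCols A₁ B₁).rank :=
    exists_inertia_eq_min hA₁ hA₂ hT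
  obtain ⟨Xc, hXc, hXcn⟩ : ∃ X ∈ T, negInertia (φ X) + (fromCols A₂ B₂).rank = negInertia M :=
    exists_negInertia_eq_max hA₁ hA₂ hT
  have hXas := hsum Xa hXa
  have hXbs := hsum Xb hXb
  have hXcs := hsum Xc hXc
  have hunit : ∀ X, IsUnit (φ X) ↔ (φ X).rank = m₁ := fun X => by
    rw [isUnit_iff_rank_eq_card, Fintype.card_fin]
  have hpsd : ∀ X ∈ T, ((φ X).PosSemidef ↔ negInertia (φ X) = 0) :=
    fun X hX => posSemidef_iff_negInertia_eq_zero (hφ X hX)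
  have hnsd : ∀ X ∈ T, ((-φ X).PosSemidef ↔ posInertia (φ X) = 0) := fun X hX => by
    rw [posSemidef_iff_negInertia_eq_zero (hφ X hX).neg, negInertia_neg (hφ X hX)]
  have hpd : ∀ X ∈ T, ((φ X).PosDef ↔ posInertia (φ X) = m₁) := fun X hX => by
    rw [posDef_iff_posInertia_eq_card (hφ X hX), Fintype.card_fin]
  have hnd : ∀ X ∈ T, ((-φ X).PosDef ↔ negInertia (φ X) = m₁) := fun X hX => by
    rw [posDef_iff_posInertia_eq_card (hφ X hX).neg, posInertia_neg (hφ X hX), Fintype.card_fin]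
  have hle : ∀ X, (φ X).rank ≤ m₁ := fun X => by
    simpa using rank_le_card_width (φ X)
  have hall : (∀ X ∈ T, (A₁ - B₁ * X * B₁ᴴ).PosSemidef) ↔
      negInertia M = (fromCols A₂ B₂).rank := by
    constructor
    · intro h
      have := (hpsd Xc hXc).1 (h Xc hXc)
      omega
    · intro h X hX
      have := hnmax X hX
      exact (hpsd X hX).2 (by omega)
  refine ⟨⟨⟨Xa, hXa, by simp only; omega⟩, ?_⟩, ⟨⟨Xb, hXb, by simp only; omega⟩, ?_⟩,
    ⟨⟨Xa, hXa, by simp only; omega⟩, ?_⟩, ⟨⟨Xb, hXb, by simp only; omega⟩, ?_⟩,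
    ⟨⟨Xc, hXc, by simp only; omega⟩, ?_⟩, ⟨⟨Xb, hXb, by simp only; omega⟩, ?_⟩,
    ?_, ?_, ?_, ?_, ?_, ?_, ?_, hall, ?_, ?_, ?_, ?_⟩
  · rintro _ ⟨X, -, rfl⟩
    exact Int.ofNat_le.2 (hrank X)
  · rintro _ ⟨X, hX, rfl⟩
    have := hsum X hX
    have := hpmin X hX
    have := hnmin X hX
    simp only
    omega
  · rintro _ ⟨X, hX, rfl⟩
    exact Int.ofNat_le.2 (hpmax X hX)
  · rintro _ ⟨X, hX, rfl⟩
    have := hpmin X hX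
    simp only
    omega
  · rintro _ ⟨X, hX, rfl⟩
    have := hnmax X hX
    simp only
    omega
  · rintro _ ⟨X, hX, rfl⟩
    have := hnmin X hX
    simp only
    omega
  · constructor
    · rintro ⟨X, -, hX⟩
      have h1 := (hunit X).1 hX
      have h2 := hrank X
      have h3 := hle Xa
      omega
    · exact fun h => ⟨Xa, hXa, (hunit Xa).2 (hXar.trans h)⟩
  · constructor
    · intro h
      have h1 := (hunit Xa).1 (h Xa hXa)
      have h2 := (hunit Xb).1 (h Xb hXb)
      omega
    · rintro ⟨h1, h2⟩ X hX
      have := hsum X hX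
      have := hpmin X hX
      have := hnmin X hX
      have := hle X
      exact (hunit X).2 (by omega)
  · constructor
    · rintro ⟨X, hX, h⟩
      have hcol : colSpace A₁ ≤ colSpace B₁ := by
        rintro _ ⟨x, rfl⟩
        refine ⟨X *ᵥ (B₁ᴴ *ᵥ x), ?_⟩
        rw [mulVecLin_apply, mulVec_mulVec, mulVec_mulVec, h,
          mulVecLin_apply]
      have h0 : (φ X).rank = 0 := eq_zero_iff_rank_eq_zero.1 (sub_eq_zero.2 h.symm)
      have h1 : _ ∧ N.rank = _ := ranks_of_colSpace_le hA₁ B₂ hcol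
      have h2 := hsum X hX
      have h3 := hpmin X hX
      have h4 : posInertia M = _ := posInertia_blockM hA₁ hA₂
      exact ⟨hcol, by omega⟩
    · rintro ⟨hcol, h⟩
      -- Under the column space inclusion the minimal rank reduces to i₊(M) - r[B₁; B₂].
      have h1 : (fromCols A₁ B₁).rank = posInertia M₁ ∧ N.rank = _ :=
        ranks_of_colSpace_le hA₁ B₂ hcol
      refine ⟨Xb, hXb, (sub_eq_zero.1 ?_).symm⟩
      exact eq_zero_iff_rank_eq_zero.2 (show (φ Xb).rank = 0 by omega)
  · constructor
    · rintro ⟨X, hX, h⟩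
      have h1 := (hpd X hX).1 h
      have h2 := hpmax X hX
      have h3 := hle Xa
      omega
    · exact fun h => ⟨Xa, hXa, (hpd Xa hXa).2 (hXap.trans h)⟩
  · simp only [hneg]
    constructor
    · rintro ⟨X, hX, h⟩
      have h1 := (hnd X hX).1 h
      have h2 := hnmax X hX
      have h3 := hle Xc
      omega
    · exact fun h => ⟨Xc, hXc, (hnd Xc hXc).2 (by omega)⟩
  · constructor
    · rintro ⟨X, hX, h⟩
      have h1 := (hpsd X hX).1 h
      have h2 := hnmin X hX
      omega
    · exact fun h => ⟨Xb, hXb, (hpsd Xb hXb).2 (by omega)⟩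
  · simp only [hneg]
    constructor
    · rintro ⟨X, hX, h⟩
      have h1 := (hnsd X hX).1 h
      have h2 := hpmin X hX
      have h3 := hnmin X hX
      omega
    · exact fun h => ⟨Xb, hXb, (hnsd Xb hXb).2 (by omega)⟩
  · rw [← hall]
    exact ⟨fun h X hX => (h hX).2, fun h X hX => ⟨hX.1, h X hX⟩⟩
  · constructor
    · intro h
      have := h Xa hXa Xb hXb
      omega
    · intro h X hX Y hY
      have h1 := hsum X hX
      have h2 := hpmin X hX
      have h3 := hnmin X hX
      have h4 := hsum Y hY
      have h5 := hpmin Y hY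
      have h6 := hnmin Y hY
      have h7 := hrank X
      have h8 := hrank Y
      omega
  · constructor
    · intro h
      have := h Xa hXa Xb hXb
      omega
    · intro h X hX Y hY
      have h1 := hpmin X hX
      have h2 := hpmax X hX
      have h3 := hpmin Y hY
      have h4 := hpmax Y hY
      omega
  · constructor
    · intro h
      have := h Xc hXc Xb hXb
      omega
    · intro h X hX Y hY
      have h1 := hnmin X hX
      have h2 := hnmax X hX
      have h3 := hnmin Y hY
      have h4 := hnmax Y hY
      omega
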